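/- A quadric surface in Euclidean $3$-space $\mathbb{E}^3$ is the zero set $S$ of a real polynomial of degree two in three variables that contains a piece of a regular surface (so $S$ is not empty, a point or a line) and is not the union of two distinct planes; a single (double) plane is allowed. For a regular smooth local parametrization $\boldsymbol{x}(u,v)$ of a part of $S$ let $g_{ij}$ be the coefficients of the first fundamental form $I$, $g=\det(g_{ij})$, $(g^{ij})=(g_{ij})^{-1}$, let $$\boldsymbol{n}=\frac{\boldsymbol{x}_u\times\boldsymbol{x}_v}{|\boldsymbol{x}_u\times\boldsymbol{x}_v|}$$ be the Gauss map and let $$\Delta^I f=-\frac{1}{\sqrt g}\sum_{i,j}\partial_i\bigl(\sqrt g\,g^{ij}\,\partial_j f\bigr)$$ be the Laplace–Beltrami operator of $I$, applied to vector-valued functions componentwise. **Theorem.** Let $S$ be a quadric surface in $\mathbb{E}^3$. There is a constant matrix $\Lambda\in\mathbb{R}^{3\times 3}$ such that $\Delta^I\boldsymbol{n}=\Lambda\boldsymbol{n}$ in every regular local parametrization of $S$ if and only if $S$ is a plane, a circular cylinder or a sphere. -/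

import Mathlib

open scoped ContDiff

namespace QuadricGauss

noncomputable section

/-- Euclidean 3-space. -/
abbrev E3 : Type := EuclideanSpace ℝ (Fin 3)

/-- Partial derivative in the first parameter. -/
def du {V : Type*} [NormedAddCommGroup V] [NormedSpace ℝ V] (f : ℝ × ℝ → V) (p : ℝ × ℝ) : V :=
  fderiv ℝ f p (1, 0)

/-- Partial derivative in the second parameter. -/
def dv {V : Type*} [NormedAddCommGroup V] [NormedSpace ℝ V] (f : ℝ × ℝ → V) (p : ℝ × ℝ) : V :=
  fderiv ℝ f p (0, 1)

/-- Cross product of Euclidean 3-space. -/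
def cross (a b : E3) : E3 := WithLp.toLp 2 (crossProduct a.ofLp b.ofLp)

/-- A regular parametric representation `x = x(u, v)`, over the open set `U`, of a part of `S`. -/
structure IsRegularPatch (S : Set E3) (U : Set (ℝ × ℝ)) (x : ℝ × ℝ → E3) : Prop where
  isOpen : IsOpen U
  smooth : ContDiffOn ℝ ∞ x U
  regular : ∀ p ∈ U, cross (du x p) (dv x p) ≠ 0
  mapsTo : Set.MapsTo x U S

/-- The Gauss map `n = (x_u × x_v) / |x_u × x_v|` of a parametrized surface. -/
def gaussMap (x : ℝ × ℝ → E3) (p : ℝ × ℝ) : E3 :=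
  ‖cross (du x p) (dv x p)‖⁻¹ • cross (du x p) (dv x p)

/-- The coefficient `g₁₁` of the first fundamental form. -/
def g11 (x : ℝ × ℝ → E3) (p : ℝ × ℝ) : ℝ := inner ℝ (du x p) (du x p)

/-- The coefficient `g₁₂` of the first fundamental form. -/
def g12 (x : ℝ × ℝ → E3) (p : ℝ × ℝ) : ℝ := inner ℝ (du x p) (dv x p)

/-- The coefficient `g₂₂` of the first fundamental form. -/
def g22 (x : ℝ × ℝ → E3) (p : ℝ × ℝ) : ℝ := inner ℝ (dv x p) (dv x p)

/-- The discriminant `g = det (g_{ij})` of the first fundamental form. -/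
def gdet (x : ℝ × ℝ → E3) (p : ℝ × ℝ) : ℝ := g11 x p * g22 x p - g12 x p ^ 2

/-- The Laplace–Beltrami operator of the first fundamental form, with the geometers' sign:
`Δ f = -(1/√g) ∑ᵢⱼ ∂ᵢ (√g gⁱʲ ∂ⱼ f)`, where `(gⁱʲ)` is the inverse of `(g_{ij})`, that is
`g¹¹ = g₂₂ / g`, `g¹² = -g₁₂ / g`, `g²² = g₁₁ / g`. -/
def laplaceBeltrami (x : ℝ × ℝ → E3) (f : ℝ × ℝ → ℝ) (p : ℝ × ℝ) : ℝ :=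
  -(1 / √(gdet x p)) *
    (du (fun q => √(gdet x q) *
        ((g22 x q / gdet x q) * du f q + (-g12 x q / gdet x q) * dv f q)) p
      + dv (fun q => √(gdet x q) *
        ((-g12 x q / gdet x q) * du f q + (g11 x q / gdet x q) * dv f q)) p)

/-- The Gauss map `n` of `S` satisfies `Δ n = Λ n` (with `Δ` acting on each component of `n`), in
every regular parametric representation of a part of `S`, with the same matrix `Λ`. Reversing the
orientation replaces `n` by `-n` and does not affect the equation. -/
def GaussMapSatisfies (S : Set E3) (Λ : Matrix (Fin 3) (Fin 3) ℝ) : Prop :=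
  ∀ (U : Set (ℝ × ℝ)) (x : ℝ × ℝ → E3), IsRegularPatch S U x →
    ∀ p ∈ U, ∀ i : Fin 3,
      laplaceBeltrami x (fun q => gaussMap x q i) p = ∑ j : Fin 3, Λ i j * gaussMap x p j

/-- `S` is a plane. -/
def IsPlane (S : Set E3) : Prop :=
  ∃ (v : E3) (d : ℝ), v ≠ 0 ∧ S = {p | inner ℝ v p = d}

/-- `S` is a circular cylinder: the set of points at distance `r > 0` from the line through `a`
with unit direction `v`. -/
def IsCircularCylinder (S : Set E3) : Prop :=
  ∃ (a v : E3) (r : ℝ), ‖v‖ = 1 ∧ 0 < r ∧ S = {p | ‖(p - a) - (inner ℝ v (p - a) : ℝ) • v‖ = r}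

/-- `S` is a sphere. -/
def IsSphere (S : Set E3) : Prop :=
  ∃ (c : E3) (r : ℝ), 0 < r ∧ S = Metric.sphere c r

/-- `S` is the zero set of a real polynomial of degree two in three variables. -/
def IsQuadric (S : Set E3) : Prop :=
  ∃ (A : Matrix (Fin 3) (Fin 3) ℝ) (b : Fin 3 → ℝ) (c : ℝ), A.IsSymm ∧ A ≠ 0 ∧
    S = {p : E3 | (∑ i, ∑ j, A i j * p i * p j) + (∑ i, b i * p i) + c = 0}

/-- A quadric surface: a quadric that is two-dimensional (so not empty, a point or a line) and is
not a pair of distinct planes. -/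
structure IsQuadricSurface (S : Set E3) : Prop where
  isQuadric : IsQuadric S
  exists_patch : ∃ (U : Set (ℝ × ℝ)) (x : ℝ × ℝ → E3), U.Nonempty ∧ IsRegularPatch S U x
  not_pair_of_planes : ¬ ∃ P Q : Set E3, IsPlane P ∧ IsPlane Q ∧ P ≠ Q ∧ S = P ∪ Q

end

end QuadricGauss

/-!
In an affine field of unit normals, `n = M x + d`, the identity `Δ x = 2 H n` in its cross-product
form gives `Δ n = M ((tr M) n - Mᵀ n)`, a linear expression in `n`; planes, circular cylinders and
spheres all carry such a field.

Conversely, the normal component of `Δ n = Λ n` reads `|II|² = ⟪n, Λ n⟫`. On a quadric with Hessian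
`D`, multiplying by powers of the length of the gradient `N` turns this into a polynomial identity
in `N`. Restricted to the plane spanned by two principal directions, it becomes a divisibility
between polynomials in one variable, and evaluating at the isotropic direction `‖N‖² = 0`, which is
reached only after extending the polynomials beyond the real points of the surface, forces a centre
to exist and the non-zero principal values to coincide. What is left is a tube around an affine
subspace, unless the surface is a cone; for a cone the identity can be rescaled, and it degenerates
to a pair of planes or a double plane.
-/

namespace QuadricGauss

open Filter Topology

/-! ### The cross product -/

lemma cross_eq (a b : E3) : cross a b =
    !₂[a 1 * b 2 - a 2 * b 1, a 2 * b 0 - a 0 * b 2, a 0 * b 1 - a 1 * b 0] := by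
  rw [cross, cross_apply]

lemma inner_eq_sum_three (a b : E3) : inner ℝ a b = a 0 * b 0 + a 1 * b 1 + a 2 * b 2 := by
  simp only [PiLp.inner_apply, Fin.sum_univ_three, RCLike.inner_apply, conj_trivial]
  ring

lemma cross_anticomm (a b : E3) : -cross a b = cross b a := by
  rw [cross, cross, ← WithLp.toLp_neg, _root_.cross_anticomm]

lemma cross_smul_left (t : ℝ) (a b : E3) : cross (t • a) b = t • cross a b := by
  simp [cross]

lemma cross_smul_right (t : ℝ) (a b : E3) : cross a (t • b) = t • cross a b := by
  simp [cross]

lemma cross_cross (a b c : E3) :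
    cross a (cross b c) = (inner ℝ a c : ℝ) • b - (inner ℝ a b : ℝ) • c := by
  ext i
  fin_cases i <;> simp [cross_eq, inner_eq_sum_three] <;> ring

lemma inner_self_cross (a b : E3) : inner ℝ a (cross a b) = (0 : ℝ) := by
  simp only [EuclideanSpace.inner_eq_star_dotProduct, cross, star_trivial, dotProduct_comm,
    dot_self_cross]

lemma inner_cross_self (a b : E3) : inner ℝ b (cross a b) = (0 : ℝ) := by
  rw [← cross_anticomm b a, inner_neg_right, inner_self_cross, neg_zero]

lemma norm_cross_sq (a b : E3) :
    ‖cross a b‖ ^ 2 = inner ℝ a a * inner ℝ b b - inner ℝ a b ^ 2 := by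
  rw [← real_inner_self_eq_norm_sq]
  simp only [cross_eq, inner_eq_sum_three, Matrix.cons_val]
  ring

lemma norm_cross_le (a b : E3) : ‖cross a b‖ ≤ ‖a‖ * ‖b‖ := by
  refine le_of_sq_le_sq ?_ (by positivity)
  rw [norm_cross_sq, real_inner_self_eq_norm_sq, real_inner_self_eq_norm_sq, mul_pow]
  exact sub_le_self _ (sq_nonneg _)

/-- The cross product as a continuous bilinear map, so that it can be differentiated. -/
noncomputable def crossCLM : E3 →L[ℝ] E3 →L[ℝ] E3 :=
  LinearMap.mkContinuous₂
    (LinearMap.mk₂ ℝ cross (by simp [cross]) cross_smul_left (by simp [cross]) cross_smul_right) 1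
    (fun a b => by rw [one_mul]; exact norm_cross_le a b)

lemma crossCLM_apply (a b : E3) : crossCLM a b = cross a b := rfl

lemma cross_map_add_map_cross (M : E3 →L[ℝ] E3) (a b : E3) :
    cross a (M b) + cross (M a) b =
      LinearMap.trace ℝ E3 M • cross a b - ContinuousLinearMap.adjoint M (cross a b) := by
  obtain ⟨A, rfl⟩ := EquivLike.surjective (Matrix.toEuclideanCLM (n := Fin 3) (𝕜 := ℝ)) M
  rw [← ContinuousLinearMap.star_eq_adjoint, ← map_star,
    Matrix.coe_toEuclideanCLM_eq_toEuclideanLin, Matrix.toEuclideanLin_eq_toLin_orthonormal,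
    Matrix.trace_toLin_eq]
  ext i
  fin_cases i <;>
    simp [cross_eq, Matrix.trace, Matrix.mulVec, dotProduct, Fin.sum_univ_three,
      Matrix.star_eq_conjTranspose] <;>
    ring

lemma eq_inner_smul_of_inner_eq_zero {a b w : E3} (hm : cross a b ≠ 0)
    (ha : inner ℝ w a = (0 : ℝ)) (hb : inner ℝ w b = (0 : ℝ)) :
    w = (inner ℝ w (‖cross a b‖⁻¹ • cross a b) : ℝ) • ‖cross a b‖⁻¹ • cross a b := by
  have hw : cross w (cross a b) = 0 := by rw [cross_cross, ha, hb, zero_smul, zero_smul, sub_zero]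
  have h : ‖cross a b‖ ^ 2 • w = (inner ℝ w (cross a b) : ℝ) • cross a b := by
    have h := cross_cross (cross a b) w (cross a b)
    rwa [hw, ← crossCLM_apply, map_zero, eq_comm, sub_eq_zero, real_inner_self_eq_norm_sq,
      real_inner_comm] at h
  rw [inner_smul_right, smul_smul, mul_right_comm, mul_smul, ← h, smul_smul, ← sq, inv_pow,
    inv_mul_cancel₀ (by positivity), one_smul]

/-! ### The Laplacian of the Gauss map -/

section Derivatives

variable {V W : Type*} [NormedAddCommGroup V] [NormedSpace ℝ V] [NormedAddCommGroup W]
  [NormedSpace ℝ W] {f : ℝ × ℝ → V} {p : ℝ × ℝ}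

lemma contDiffAt_du (hf : ContDiffAt ℝ ∞ f p) : ContDiffAt ℝ ∞ (du f) p :=
  (hf.fderiv_right (by simp)).clm_apply contDiffAt_const

lemma contDiffAt_dv (hf : ContDiffAt ℝ ∞ f p) : ContDiffAt ℝ ∞ (dv f) p :=
  (hf.fderiv_right (by simp)).clm_apply contDiffAt_const

lemma du_congr {g : ℝ × ℝ → V} (h : f =ᶠ[𝓝 p] g) : du f p = du g p := by
  rw [du, du, h.fderiv_eq]

lemma dv_congr {g : ℝ × ℝ → V} (h : f =ᶠ[𝓝 p] g) : dv f p = dv g p := by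
  rw [dv, dv, h.fderiv_eq]

lemma du_clm_comp (φ : V →L[ℝ] W) (hf : DifferentiableAt ℝ f p) :
    du (fun q => φ (f q)) p = φ (du f p) :=
  congrArg (· (1, 0)) (φ.hasFDerivAt.comp p hf.hasFDerivAt).fderiv

lemma dv_clm_comp (φ : V →L[ℝ] W) (hf : DifferentiableAt ℝ f p) :
    dv (fun q => φ (f q)) p = φ (dv f p) :=
  congrArg (· (0, 1)) (φ.hasFDerivAt.comp p hf.hasFDerivAt).fderiv

lemma du_dv_comm (hf : ContDiffAt ℝ ∞ f p) : du (dv f) p = dv (du f) p := by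
  have hsymm : IsSymmSndFDerivAt ℝ f p :=
    hf.isSymmSndFDerivAt (by
      rw [minSmoothness_of_isRCLikeNormedField]
      exact WithTop.coe_le_coe.2 le_top)
  have hd : DifferentiableAt ℝ (fderiv ℝ f) p :=
    (hf.fderiv_right (m := ∞) (by simp)).differentiableAt (by simp)
  have hd₂ (z w : ℝ × ℝ) :
      fderiv ℝ (fun q => fderiv ℝ f q w) p z = fderiv ℝ (fderiv ℝ f) p z w := by
    simp [fderiv_clm_apply hd (differentiableAt_const w)]
  exact (hd₂ _ _).trans ((hsymm.eq _ _).trans (hd₂ _ _).symm)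

end Derivatives

lemma fderiv_cross_apply {f g : ℝ × ℝ → E3} {p : ℝ × ℝ} (hf : DifferentiableAt ℝ f p)
    (hg : DifferentiableAt ℝ g p) (z : ℝ × ℝ) :
    fderiv ℝ (fun q => cross (f q) (g q)) p z =
      cross (f p) (fderiv ℝ g p z) + cross (fderiv ℝ f p z) (g p) :=
  congrArg (· z) (crossCLM.fderiv_of_bilinear hf hg)

lemma inner_fderiv_add_inner_fderiv_of_inner_eq_const {E F : Type*} [NormedAddCommGroup E]
    [NormedSpace ℝ E] [NormedAddCommGroup F] [InnerProductSpace ℝ F] {f g : E → F} {p : E} {c : ℝ}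
    (hf : DifferentiableAt ℝ f p) (hg : DifferentiableAt ℝ g p)
    (hfg : ∀ᶠ q in 𝓝 p, inner ℝ (f q) (g q) = c) (z : E) :
    inner ℝ (f p) (fderiv ℝ g p z) + inner ℝ (fderiv ℝ f p z) (g p) = (0 : ℝ) := by
  have hconst : (fun q => (inner ℝ (f q) (g q) : ℝ)) =ᶠ[𝓝 p] fun _ => c := hfg
  rw [← fderiv_inner_apply ℝ hf hg, hconst.fderiv_eq, fderiv_const_apply, zero_apply]

section GaussMap

variable {x : ℝ × ℝ → E3} {p : ℝ × ℝ}

lemma sqrt_gdet (x : ℝ × ℝ → E3) (p : ℝ × ℝ) : √(gdet x p) = ‖cross (du x p) (dv x p)‖ := by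
  rw [gdet, g11, g22, g12, ← norm_cross_sq, Real.sqrt_sq (norm_nonneg _)]

lemma gdet_eq_norm_sq (x : ℝ × ℝ → E3) (p : ℝ × ℝ) :
    gdet x p = ‖cross (du x p) (dv x p)‖ ^ 2 :=
  (norm_cross_sq _ _).symm

lemma norm_gaussMap (h : cross (du x p) (dv x p) ≠ 0) : ‖gaussMap x p‖ = 1 :=
  norm_smul_inv_norm h

lemma inner_gaussMap_fderiv (x : ℝ × ℝ → E3) (p z : ℝ × ℝ) :
    inner ℝ (gaussMap x p) (fderiv ℝ x p z) = (0 : ℝ) := by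
  have hz : fderiv ℝ x p z = z.1 • du x p + z.2 • dv x p := by
    rw [du, dv, ← map_smul, ← map_smul, ← map_add]
    simp
  rw [hz, gaussMap, inner_smul_left, inner_add_right, inner_smul_right, inner_smul_right,
    real_inner_comm, inner_self_cross, real_inner_comm, inner_cross_self, mul_zero, mul_zero,
    add_zero, mul_zero]

end GaussMap

section Laplacian

variable {V : Type*} [NormedAddCommGroup V] [NormedSpace ℝ V]

/-- The first component `√g (g¹¹ f_u + g¹² f_v)` of the density whose divergence is `-√g Δ f`. -/
noncomputable def fluxU (x : ℝ × ℝ → E3) (f : ℝ × ℝ → V) (q : ℝ × ℝ) : V :=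
  √(gdet x q) • ((g22 x q / gdet x q) • du f q + (-g12 x q / gdet x q) • dv f q)

/-- The second component `√g (g²¹ f_u + g²² f_v)` of the density whose divergence is `-√g Δ f`. -/
noncomputable def fluxV (x : ℝ × ℝ → E3) (f : ℝ × ℝ → V) (q : ℝ × ℝ) : V :=
  √(gdet x q) • ((-g12 x q / gdet x q) • du f q + (g11 x q / gdet x q) • dv f q)

/-- The Laplace–Beltrami operator on vector-valued functions, written without coordinates of the
target so that it commutes with linear maps. -/
noncomputable def vectorLaplacian (x : ℝ × ℝ → E3) (f : ℝ × ℝ → V) (p : ℝ × ℝ) : V :=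
  -(1 / √(gdet x p)) • (du (fluxU x f) p + dv (fluxV x f) p)

lemma laplaceBeltrami_eq_vectorLaplacian : laplaceBeltrami = vectorLaplacian (V := ℝ) := rfl

lemma vectorLaplacian_congr (x : ℝ × ℝ → E3) {f g : ℝ × ℝ → V} {p : ℝ × ℝ} (h : f =ᶠ[𝓝 p] g) :
    vectorLaplacian x f p = vectorLaplacian x g p := by
  have hU : fluxU x f =ᶠ[𝓝 p] fluxU x g :=
    h.eventuallyEq_nhds.mono fun q hq => by rw [fluxU, fluxU, du_congr hq, dv_congr hq]
  have hV : fluxV x f =ᶠ[𝓝 p] fluxV x g :=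
    h.eventuallyEq_nhds.mono fun q hq => by rw [fluxV, fluxV, du_congr hq, dv_congr hq]
  rw [vectorLaplacian, vectorLaplacian, du_congr hU, dv_congr hV]

lemma vectorLaplacian_add_const (x : ℝ × ℝ → E3) (f : ℝ × ℝ → V) (d : V) (p : ℝ × ℝ) :
    vectorLaplacian x (fun q => f q + d) p = vectorLaplacian x f p := by
  have hdu : du (fun q => f q + d) = du f := funext fun q => by rw [du, du, fderiv_add_const]
  have hdv : dv (fun q => f q + d) = dv f := funext fun q => by rw [dv, dv, fderiv_add_const]
  have hU : fluxU x (fun q => f q + d) = fluxU x f := funext fun q => by rw [fluxU, hdu, hdv, fluxU]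
  have hV : fluxV x (fun q => f q + d) = fluxV x f := funext fun q => by rw [fluxV, hdu, hdv, fluxV]
  rw [vectorLaplacian, hU, hV, vectorLaplacian]

end Laplacian

namespace IsRegularPatch

variable {V W : Type*} [NormedAddCommGroup V] [NormedSpace ℝ V] [NormedAddCommGroup W]
  [NormedSpace ℝ W] {S : Set E3} {U : Set (ℝ × ℝ)} {x : ℝ × ℝ → E3} {p : ℝ × ℝ}

lemma eventually_mem (h : IsRegularPatch S U x) (hp : p ∈ U) : ∀ᶠ q in 𝓝 p, q ∈ U :=
  h.isOpen.mem_nhds hp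

lemma contDiffAt (h : IsRegularPatch S U x) (hp : p ∈ U) : ContDiffAt ℝ ∞ x p :=
  h.smooth.contDiffAt (h.isOpen.mem_nhds hp)

lemma differentiableAt (h : IsRegularPatch S U x) (hp : p ∈ U) : DifferentiableAt ℝ x p :=
  (h.contDiffAt hp).differentiableAt (by simp)

lemma contDiffAt_gaussMap (h : IsRegularPatch S U x) (hp : p ∈ U) :
    ContDiffAt ℝ ∞ (gaussMap x) p := by
  have hm : ContDiffAt ℝ ∞ (fun q => cross (du x q) (dv x q)) p :=
    (crossCLM.contDiff.contDiffAt.comp p (contDiffAt_du (h.contDiffAt hp))).clm_apply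
      (contDiffAt_dv (h.contDiffAt hp))
  exact ((hm.norm ℝ (h.regular p hp)).inv (norm_ne_zero_iff.2 (h.regular p hp))).smul hm

lemma differentiableAt_gaussMap (h : IsRegularPatch S U x) (hp : p ∈ U) :
    DifferentiableAt ℝ (gaussMap x) p :=
  (h.contDiffAt_gaussMap hp).differentiableAt (by simp)

lemma gdet_ne_zero (h : IsRegularPatch S U x) (hp : p ∈ U) : gdet x p ≠ 0 := by
  rw [gdet_eq_norm_sq]
  exact pow_ne_zero 2 (norm_ne_zero_iff.2 (h.regular p hp))

lemma differentiableAt_flux (h : IsRegularPatch S U x) (hp : p ∈ U) {f : ℝ × ℝ → V}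
    (hf : ContDiffAt ℝ ∞ f p) :
    DifferentiableAt ℝ (fluxU x f) p ∧ DifferentiableAt ℝ (fluxV x f) p := by
  have hfu := contDiffAt_du hf
  have hfv := contDiffAt_dv hf
  have hxu := contDiffAt_du (h.contDiffAt hp)
  have hxv := contDiffAt_dv (h.contDiffAt hp)
  have hg : ContDiffAt ℝ ∞ (gdet x) p :=
    ((hxu.inner ℝ hxu).mul (hxv.inner ℝ hxv)).sub ((hxu.inner ℝ hxv).pow 2)
  have hg₁₁ := (hxu.inner ℝ hxu).div hg (h.gdet_ne_zero hp)
  have hg₁₂ := (hxu.inner ℝ hxv).neg.div hg (h.gdet_ne_zero hp)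
  have hg₂₂ := (hxv.inner ℝ hxv).div hg (h.gdet_ne_zero hp)
  have hsqrt := hg.sqrt (h.gdet_ne_zero hp)
  exact ⟨(hsqrt.smul ((hg₂₂.smul hfu).add (hg₁₂.smul hfv))).differentiableAt (by simp),
    (hsqrt.smul ((hg₁₂.smul hfu).add (hg₁₁.smul hfv))).differentiableAt (by simp)⟩

lemma vectorLaplacian_clm_comp (h : IsRegularPatch S U x) (hp : p ∈ U) {f : ℝ × ℝ → V}
    (hf : ContDiffAt ℝ ∞ f p) (φ : V →L[ℝ] W) :
    vectorLaplacian x (fun q => φ (f q)) p = φ (vectorLaplacian x f p) := by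
  have hdiff : ∀ᶠ q in 𝓝 p, DifferentiableAt ℝ f q :=
    ((hf.of_le (m := 1) (by simp)).eventually (by simp)).mono fun q hq =>
      hq.differentiableAt one_ne_zero
  have hU : fluxU x (fun q => φ (f q)) =ᶠ[𝓝 p] fun q => φ (fluxU x f q) := hdiff.mono fun q hq => by
    simp only [fluxU, du_clm_comp φ hq, dv_clm_comp φ hq, map_add, map_smul]
  have hV : fluxV x (fun q => φ (f q)) =ᶠ[𝓝 p] fun q => φ (fluxV x f q) := hdiff.mono fun q hq => by
    simp only [fluxV, du_clm_comp φ hq, dv_clm_comp φ hq, map_add, map_smul]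
  obtain ⟨hdU, hdV⟩ := h.differentiableAt_flux hp hf
  rw [vectorLaplacian, du_congr hU, dv_congr hV, du_clm_comp φ hdU, dv_clm_comp φ hdV, ← map_add,
    ← map_smul, vectorLaplacian]

lemma fluxU_self (h : IsRegularPatch S U x) (hp : p ∈ U) :
    fluxU x x p = cross (dv x p) (gaussMap x p) := by
  have hm : ‖cross (du x p) (dv x p)‖ ≠ 0 := norm_ne_zero_iff.2 (h.regular p hp)
  rw [fluxU, gaussMap, cross_smul_right, cross_cross, gdet_eq_norm_sq, Real.sqrt_sq (norm_nonneg _),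
    g22, g12, real_inner_comm (du x p)]
  match_scalars <;> field_simp

lemma fluxV_self (h : IsRegularPatch S U x) (hp : p ∈ U) :
    fluxV x x p = cross (gaussMap x p) (du x p) := by
  have hm : ‖cross (du x p) (dv x p)‖ ≠ 0 := norm_ne_zero_iff.2 (h.regular p hp)
  rw [fluxV, gaussMap, cross_smul_left, ← cross_anticomm (du x p), cross_cross, gdet_eq_norm_sq,
    Real.sqrt_sq (norm_nonneg _), g11, g12]
  match_scalars <;> field_simp

lemma vectorLaplacian_self (h : IsRegularPatch S U x) (hp : p ∈ U) :
    vectorLaplacian x x p = -‖cross (du x p) (dv x p)‖⁻¹ •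
      (cross (dv x p) (du (gaussMap x) p) + cross (dv (gaussMap x) p) (du x p)) := by
  have hxu := (contDiffAt_du (h.contDiffAt hp)).differentiableAt (by simp)
  have hxv := (contDiffAt_dv (h.contDiffAt hp)).differentiableAt (by simp)
  have hn := h.differentiableAt_gaussMap hp
  have hU : du (fluxU x x) p =
      cross (dv x p) (du (gaussMap x) p) + cross (du (dv x) p) (gaussMap x p) := by
    rw [du_congr ((h.eventually_mem hp).mono fun q hq => h.fluxU_self hq)]
    exact fderiv_cross_apply hxv hn _
  have hV : dv (fluxV x x) p =
      cross (gaussMap x p) (dv (du x) p) + cross (dv (gaussMap x) p) (du x p) := by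
    rw [dv_congr ((h.eventually_mem hp).mono fun q hq => h.fluxV_self hq)]
    exact fderiv_cross_apply hn hxu _
  rw [vectorLaplacian, hU, hV, sqrt_gdet, one_div, du_dv_comm (h.contDiffAt hp),
    ← cross_anticomm (dv (du x) p)]
  module

lemma vectorLaplacian_gaussMap_of_affine (h : IsRegularPatch S U x) (hp : p ∈ U)
    {M : E3 →L[ℝ] E3} {d : E3} (hM : gaussMap x =ᶠ[𝓝 p] fun q => M (x q) + d) :
    vectorLaplacian x (gaussMap x) p = M (LinearMap.trace ℝ E3 M • gaussMap x p -
      ContinuousLinearMap.adjoint M (gaussMap x p)) := by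
  have hnu : du (gaussMap x) p = M (du x p) := by
    rw [du_congr hM, ← du_clm_comp M (h.differentiableAt hp), du, du, fderiv_add_const]
  have hnv : dv (gaussMap x) p = M (dv x p) := by
    rw [dv_congr hM, ← dv_clm_comp M (h.differentiableAt hp), dv, dv, fderiv_add_const]
  rw [vectorLaplacian_congr x hM, vectorLaplacian_add_const,
    h.vectorLaplacian_clm_comp hp (h.contDiffAt hp), h.vectorLaplacian_self hp, hnu, hnv,
    cross_map_add_map_cross, gaussMap, ← cross_anticomm (du x p)]
  congr 1
  simp only [map_neg, map_smul]
  module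

lemma inner_vectorLaplacian_of_norm_eq_one (h : IsRegularPatch S U x) (hp : p ∈ U)
    {f : ℝ × ℝ → E3} (hf : ContDiffAt ℝ ∞ f p) (hf₁ : ∀ᶠ q in 𝓝 p, ‖f q‖ = 1) :
    inner ℝ (f p) (vectorLaplacian x f p) = (√(gdet x p))⁻¹ *
      (inner ℝ (du f p) (fluxU x f p) + inner ℝ (dv f p) (fluxV x f p)) := by
  have hort : ∀ᶠ q in 𝓝 p, ∀ z, inner ℝ (f q) (fderiv ℝ f q z) = (0 : ℝ) := by
    filter_upwards [hf₁.eventually_nhds, (hf.of_le (m := 1) (by simp)).eventually (by simp)]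
      with q hq₁ hq z
    have hdq := hq.differentiableAt one_ne_zero
    have hconst : ∀ᶠ s in 𝓝 q, inner ℝ (f s) (f s) = (1 : ℝ) :=
      hq₁.mono fun s hs => inner_self_eq_one_of_norm_eq_one hs
    linarith [inner_fderiv_add_inner_fderiv_of_inner_eq_const hdq hdq hconst z,
      real_inner_comm (f q) (fderiv ℝ f q z)]
  have hdf := hf.differentiableAt (by simp)
  obtain ⟨hU, hV⟩ := h.differentiableAt_flux hp hf
  have hortU : ∀ᶠ q in 𝓝 p, inner ℝ (f q) (fluxU x f q) = (0 : ℝ) := hort.mono fun q hq => by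
    simp only [fluxU, du, dv, inner_smul_right, inner_add_right, hq, mul_zero, add_zero]
  have hortV : ∀ᶠ q in 𝓝 p, inner ℝ (f q) (fluxV x f q) = (0 : ℝ) := hort.mono fun q hq => by
    simp only [fluxV, du, dv, inner_smul_right, inner_add_right, hq, mul_zero, add_zero]
  have hdU := eq_neg_of_add_eq_zero_left
    (inner_fderiv_add_inner_fderiv_of_inner_eq_const hdf hU hortU (1, 0))
  have hdV := eq_neg_of_add_eq_zero_left
    (inner_fderiv_add_inner_fderiv_of_inner_eq_const hdf hV hortV (0, 1))
  rw [vectorLaplacian, inner_smul_right, inner_add_right, du, dv, hdU, hdV, one_div, du, dv]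
  ring

end IsRegularPatch

lemma gaussMapSatisfies_iff {S : Set E3} {Λ : Matrix (Fin 3) (Fin 3) ℝ} :
    GaussMapSatisfies S Λ ↔ ∀ U x, IsRegularPatch S U x → ∀ p ∈ U,
      vectorLaplacian x (gaussMap x) p = Matrix.toEuclideanCLM (𝕜 := ℝ) Λ (gaussMap x p) := by
  refine forall₃_congr fun U x h => forall₂_congr fun p hp => ?_
  rw [PiLp.ext_iff]
  refine forall_congr' fun i => ?_
  have hi : vectorLaplacian x (fun q => gaussMap x q i) p = vectorLaplacian x (gaussMap x) p i :=
    h.vectorLaplacian_clm_comp hp (h.contDiffAt_gaussMap hp) (EuclideanSpace.proj i)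
  rw [laplaceBeltrami_eq_vectorLaplacian, hi]
  rfl

namespace IsRegularPatch

variable {S : Set E3} {U : Set (ℝ × ℝ)} {x : ℝ × ℝ → E3} {p : ℝ × ℝ}

lemma eq_inner_smul_gaussMap (h : IsRegularPatch S U x) (hp : p ∈ U) {w : E3}
    (hw : ∀ z, inner ℝ w (fderiv ℝ x p z) = (0 : ℝ)) :
    w = (inner ℝ w (gaussMap x p) : ℝ) • gaussMap x p :=
  eq_inner_smul_of_inner_eq_zero (h.regular p hp) (hw (1, 0)) (hw (0, 1))

lemma inner_gradient_fderiv (h : IsRegularPatch S U x) (hp : p ∈ U) {F : E3 → ℝ} {c : ℝ} {N : E3}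
    (hF : HasGradientAt F N (x p)) (hS : ∀ y ∈ S, F y = c) (z : ℝ × ℝ) :
    inner ℝ N (fderiv ℝ x p z) = (0 : ℝ) := by
  have hconst : F ∘ x =ᶠ[𝓝 p] fun _ => c :=
    (h.eventually_mem hp).mono fun q hq => hS _ (h.mapsTo hq)
  have hchain := (hF.hasFDerivAt.comp p (h.differentiableAt hp).hasFDerivAt).fderiv
  rw [hconst.fderiv_eq, fderiv_const_apply] at hchain
  exact (congrArg (· z) hchain).symm

lemma eventually_gaussMap_eq_smul (h : IsRegularPatch S U x) (hp : p ∈ U) {ν : ℝ × ℝ → E3}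
    (hν : ContinuousAt ν p) (hort : ∀ q ∈ U, ∀ z, inner ℝ (ν q) (fderiv ℝ x q z) = (0 : ℝ))
    (hν₁ : ∀ q ∈ U, ‖ν q‖ = 1) :
    ∃ σ : ℝ, σ ^ 2 = 1 ∧ ∀ᶠ q in 𝓝 p, gaussMap x q = σ • ν q := by
  let s (q : ℝ × ℝ) : ℝ := inner ℝ (ν q) (gaussMap x q)
  have hνs (q) (hq : q ∈ U) : ν q = s q • gaussMap x q := h.eq_inner_smul_gaussMap hq (hort q hq)
  have hs (q) (hq : q ∈ U) : s q ^ 2 = 1 := by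
    have h₁ := hν₁ q hq
    rw [hνs q hq, norm_smul, norm_gaussMap (h.regular q hq), mul_one, Real.norm_eq_abs] at h₁
    rw [← sq_abs, h₁, one_pow]
  have hsc : ContinuousAt s p := hν.inner (h.contDiffAt_gaussMap hp).continuousAt
  refine ⟨s p, hs p hp, ?_⟩
  filter_upwards [h.eventually_mem hp, hsc.eventually (Metric.ball_mem_nhds _ one_pos)]
    with q hq hsq
  have hqp : s q = s p := by
    rw [Real.dist_eq, abs_lt] at hsq
    rcases sq_eq_one_iff.1 (hs q hq) with h₁ | h₁ <;>
      rcases sq_eq_one_iff.1 (hs p hp) with h₂ | h₂ <;> linarith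
  rw [hνs q hq, ← hqp, smul_smul, ← sq, hs q hq, one_smul]

end IsRegularPatch

/-! ### Quadratic polynomials and tubes -/

section QuadPoly

variable {E : Type*} [NormedAddCommGroup E] [InnerProductSpace ℝ E]

/-- The quadratic polynomial with Hessian `D`, gradient `b` at the origin and constant term `c`. -/
noncomputable def quadPoly (D : E →L[ℝ] E) (b : E) (c : ℝ) (y : E) : ℝ :=
  inner ℝ (D y) y / 2 + inner ℝ b y + c

variable {D : E →L[ℝ] E} {b : E} {c : ℝ}

lemma quadPoly_add (hD : (D : E →ₗ[ℝ] E).IsSymmetric) (a w : E) :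
    quadPoly D b c (a + w) = quadPoly D b c a + inner ℝ (D a + b) w + inner ℝ (D w) w / 2 := by
  have hs : inner ℝ (D w) a = inner ℝ (D a) w := (hD w a).trans (real_inner_comm _ _)
  simp only [quadPoly, map_add, inner_add_left, inner_add_right, hs]
  ring

lemma contDiff_quadPoly : ContDiff ℝ ∞ (quadPoly D b c) :=
  (((D.contDiff.inner ℝ contDiff_id).div_const 2).add (contDiff_const.inner ℝ contDiff_id)).add
    contDiff_const

lemma hasGradientAt_quadPoly [CompleteSpace E] (hD : (D : E →ₗ[ℝ] E).IsSymmetric) (y : E) :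
    HasGradientAt (quadPoly D b c) (D y + b) y := by
  rw [hasGradientAt_iff_hasFDerivAt]
  have hquad : HasFDerivAt (fun z => inner ℝ (D z) z / 2) (innerSL ℝ (D y)) y := by
    simp only [div_eq_mul_inv]
    refine ((D.hasFDerivAt.inner ℝ (hasFDerivAt_id y)).mul_const 2⁻¹).congr_fderiv
      (ContinuousLinearMap.ext fun z => ?_)
    have hs : inner ℝ (D z) y = inner ℝ (D y) z := (hD z y).trans (real_inner_comm _ _)
    simp [hs]
    ring
  refine ((hquad.add (innerSL ℝ b).hasFDerivAt).add_const c).congr_fderiv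
    (ContinuousLinearMap.ext fun z => ?_)
  simp

lemma inner_starProjection_self (K : Submodule ℝ E) [K.HasOrthogonalProjection] (w : E) :
    inner ℝ (K.starProjection w) w = ‖K.starProjection w‖ ^ 2 := by
  have h := Submodule.starProjection_inner_eq_zero w _ (K.starProjection_apply_mem w)
  rwa [inner_sub_left, sub_eq_zero, real_inner_self_eq_norm_sq, real_inner_comm] at h

/-- The set of points at distance `r` from the affine subspace through `a` orthogonal to `K`: a
sphere for `K = ⊤`, a circular cylinder when `K` is a plane, a pair of planes when `K` is a line. -/
def tube (K : Submodule ℝ E) [K.HasOrthogonalProjection] (a : E) (r : ℝ) : Set E :=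
  {y | ‖K.starProjection (y - a)‖ = r}

variable {a v : E} {r : ℝ}

lemma tube_top : tube (⊤ : Submodule ℝ E) a r = Metric.sphere a r := by
  ext y
  simp [tube, Submodule.starProjection_top]

lemma tube_span_singleton (hv : ‖v‖ = 1) :
    tube (ℝ ∙ v) a r = {y | |inner ℝ v (y - a)| = r} := by
  ext y
  simp [tube, Submodule.starProjection_unit_singleton ℝ hv, norm_smul, hv]

lemma tube_orthogonal_span_singleton (hv : ‖v‖ = 1) :
    tube (ℝ ∙ v)ᗮ a r = {y | ‖y - a - (inner ℝ v (y - a) : ℝ) • v‖ = r} := by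
  ext y
  simp [tube, Submodule.starProjection_orthogonal_val, Submodule.starProjection_unit_singleton ℝ hv]

end QuadPoly

lemma exists_gaussMapSatisfies_of_norm_gradient_eq_one {S : Set E3} {D : E3 →L[ℝ] E3} {b : E3}
    {c : ℝ} (hD : (D : E3 →ₗ[ℝ] E3).IsSymmetric) (hS : ∀ y ∈ S, quadPoly D b c y = 0)
    (hN : ∀ y ∈ S, ‖D y + b‖ = 1) : ∃ Λ, GaussMapSatisfies S Λ := by
  refine ⟨(Matrix.toEuclideanCLM (𝕜 := ℝ)).symm
    (D ∘L (LinearMap.trace ℝ E3 D • ContinuousLinearMap.id ℝ E3 - D)), ?_⟩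
  refine gaussMapSatisfies_iff.2 fun U x h p hp => ?_
  obtain ⟨σ, hσ, hn⟩ := h.eventually_gaussMap_eq_smul hp (ν := fun q => D (x q) + b)
    (by have := (h.contDiffAt hp).continuousAt; fun_prop)
    (fun q hq => h.inner_gradient_fderiv hq (hasGradientAt_quadPoly hD _) hS)
    fun q hq => hN _ (h.mapsTo hq)
  have hn' : gaussMap x =ᶠ[𝓝 p] fun q => (σ • D) (x q) + σ • b :=
    hn.mono fun q hq => by rw [hq, smul_add]; rfl
  have hadj : ContinuousLinearMap.adjoint D = D := hD.isSelfAdjoint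
  rw [h.vectorLaplacian_gaussMap_of_affine hp hn', StarAlgEquiv.apply_symm_apply]
  simp only [map_smulₛₗ, hadj, ContinuousLinearMap.toLinearMap_smul, smul_apply, map_sub,
    conj_trivial, smul_eq_mul, ContinuousLinearMap.comp_apply, sub_apply,
    ContinuousLinearMap.id_apply, RingHom.id_apply]
  linear_combination (norm := module)
    hσ • (LinearMap.trace ℝ E3 D • D (gaussMap x p) - D (D (gaussMap x p)))

lemma exists_gaussMapSatisfies_of_subset_tube {S : Set E3} {K : Submodule ℝ E3} {a : E3} {r : ℝ}
    (hr : 0 < r) (hS : S ⊆ tube K a r) : ∃ Λ, GaussMapSatisfies S Λ := by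
  let D : E3 →L[ℝ] E3 := r⁻¹ • K.starProjection
  have hD : (D : E3 →ₗ[ℝ] E3).IsSymmetric := K.starProjection_isSymmetric.smul (by simp)
  have hnorm {y : E3} (hy : y ∈ S) : ‖K.starProjection (y - a)‖ = r := hS hy
  refine exists_gaussMapSatisfies_of_norm_gradient_eq_one (b := -D a)
    (c := inner ℝ (D a) a / 2 - r / 2) hD (fun y hy => ?_) fun y hy => ?_
  · have hDy : inner ℝ (D (y - a)) (y - a) = r := by
      rw [smul_apply, real_inner_smul_left, inner_starProjection_self, hnorm hy, sq,
        inv_mul_cancel_left₀ hr.ne']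
    rw [← add_sub_cancel a y, quadPoly_add hD, add_neg_cancel, inner_zero_left, hDy, quadPoly,
      inner_neg_left]
    ring
  · rw [← sub_eq_add_neg, ← map_sub, smul_apply, norm_smul, hnorm hy, norm_inv,
      Real.norm_of_nonneg hr.le, inv_mul_cancel₀ hr.ne']

lemma IsPlane.exists_norm_eq_one {S : Set E3} (hS : IsPlane S) :
    ∃ v d, ‖v‖ = 1 ∧ S = {p : E3 | inner ℝ v p = d} := by
  obtain ⟨v, d, hv, rfl⟩ := hS
  have hv' : ‖v‖ ≠ 0 := norm_ne_zero_iff.2 hv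
  refine ⟨‖v‖⁻¹ • v, ‖v‖⁻¹ * d, norm_smul_inv_norm hv, ?_⟩
  ext p
  simp [inner_smul_left, hv']

lemma exists_gaussMapSatisfies {S : Set E3}
    (hS : IsPlane S ∨ IsCircularCylinder S ∨ IsSphere S) : ∃ Λ, GaussMapSatisfies S Λ := by
  rcases hS with hS | ⟨a, v, r, hv, hr, rfl⟩ | ⟨a, r, hr, rfl⟩
  · obtain ⟨v, d, hv, rfl⟩ := hS.exists_norm_eq_one
    refine exists_gaussMapSatisfies_of_subset_tube (K := ℝ ∙ v) (a := (d - 1) • v) one_pos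
      fun p hp => ?_
    rw [Set.mem_ofPred_eq] at hp
    simp [tube_span_singleton hv, inner_sub_right, inner_smul_right, hp, hv]
  · exact exists_gaussMapSatisfies_of_subset_tube hr (tube_orthogonal_span_singleton hv).ge
  · exact exists_gaussMapSatisfies_of_subset_tube hr tube_top.ge

/-! ### Level sets as regular surfaces -/

lemma exists_contDiffOn_rightInvOn {E : Type*} [NormedAddCommGroup E] [NormedSpace ℝ E]
    [CompleteSpace E] {Φ : E → E} {n : WithTop ℕ∞} (hn : n ≠ 0) (hΦ : ContDiff ℝ n Φ) {p : E}
    {Φ' : E ≃L[ℝ] E} (hp : HasFDerivAt Φ (Φ' : E →L[ℝ] E) p) :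
    ∃ (V : Set E) (Ψ : E → E), IsOpen V ∧ Φ p ∈ V ∧ Ψ (Φ p) = p ∧
      HasFDerivAt Ψ (Φ'.symm : E →L[ℝ] E) (Φ p) ∧ ContDiffOn ℝ n Ψ V ∧ Set.RightInvOn Ψ Φ V := by
  let e := hΦ.contDiffAt.toOpenPartialHomeomorph Φ hp hn
  have hsource : p ∈ e.source := hΦ.contDiffAt.mem_toOpenPartialHomeomorph_source hp hn
  let W : Set E := fderiv ℝ Φ ⁻¹' Set.range ((↑) : (E ≃L[ℝ] E) → E →L[ℝ] E)
  have hW : IsOpen W :=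
    ContinuousLinearEquiv.isOpen.preimage (hΦ.continuous_fderiv hn)
  have hsymm : e.symm (Φ p) = p := e.left_inv hsource
  refine ⟨e.target ∩ e.symm ⁻¹' W, e.symm, e.isOpen_inter_preimage_symm hW,
    ⟨e.map_source hsource, ?_⟩, hsymm, ?_, fun z hz => ?_, fun z hz => e.right_inv hz.1⟩
  · rw [Set.mem_preimage, hsymm]
    exact ⟨Φ', hp.fderiv.symm⟩
  · exact e.hasFDerivAt_symm (e.map_source hsource) (by rwa [hsymm])
  · obtain ⟨T, hT⟩ := hz.2
    exact (e.contDiffAt_symm hz.1 (hT ▸ (hΦ.differentiable hn _).hasFDerivAt)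
      hΦ.contDiffAt).contDiffWithinAt

lemma exists_contDiffOn_straightening {E : Type*} [NormedAddCommGroup E] [InnerProductSpace ℝ E]
    [CompleteSpace E] {F : E → ℝ} {n : WithTop ℕ∞} (hn : n ≠ 0) (hF : ContDiff ℝ n F) {p N : E}
    (hp : F p = 0) (hN : HasGradientAt F N p) (hN₀ : N ≠ 0) :
    ∃ (V : Set E) (Ψ : E → E), IsOpen V ∧ 0 ∈ V ∧ Ψ 0 = p ∧
      HasFDerivAt Ψ (ContinuousLinearMap.id ℝ E) 0 ∧ ContDiffOn ℝ n Ψ V ∧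
      ∀ z ∈ V, F (Ψ z) = inner ℝ N z := by
  -- `Φ` moves `y` along the normal so that `⟪N, Φ y⟫` becomes `F y`.
  let Φ (y : E) : E := y - p + ((‖N‖ ^ 2)⁻¹ * (F y - inner ℝ N (y - p))) • N
  have hΦ : ContDiff ℝ n Φ :=
    (contDiff_id.sub contDiff_const).add ((contDiff_const.mul
      (hF.sub (contDiff_const.inner ℝ (contDiff_id.sub contDiff_const)))).smul contDiff_const)
  have hΦp : Φ p = 0 := by simp [Φ, hp]
  have hheight (y : E) : inner ℝ N (Φ y) = F y := by
    simp only [Φ, inner_add_right, inner_smul_right, real_inner_self_eq_norm_sq]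
    field_simp
    ring
  have hderiv : HasFDerivAt Φ (ContinuousLinearEquiv.refl ℝ E : E →L[ℝ] E) p := by
    have hid := (hasFDerivAt_id (𝕜 := ℝ) p).sub_const p
    refine (hid.add (((hN.hasFDerivAt.sub
      ((innerSL ℝ N).hasFDerivAt.comp p hid)).const_mul (‖N‖ ^ 2)⁻¹).smul_const N)).congr_fderiv
      (ContinuousLinearMap.ext fun w => ?_)
    simp
  obtain ⟨V, Ψ, hV, hpV, hΨp, hΨ', hΨ, hinv⟩ := exists_contDiffOn_rightInvOn hn hΦ hderiv
  rw [hΦp] at hpV hΨp hΨ'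
  exact ⟨V, Ψ, hV, hpV, hΨp, hΨ', hΨ, fun z hz => by rw [← hheight, hinv hz]⟩

lemma exists_orthonormalBasis_apply_eq {E : Type*} [NormedAddCommGroup E] [InnerProductSpace ℝ E]
    [FiniteDimensional ℝ E] {ι : Type*} [Fintype ι] (hE : Module.finrank ℝ E = Fintype.card ι)
    (i : ι) {u : E} (hu : ‖u‖ = 1) : ∃ f : OrthonormalBasis ι ℝ E, f i = u := by
  have hon : Orthonormal ℝ (({i} : Set ι).domRestrict fun _ => u) :=
    ⟨fun _ => hu, fun j k hjk => absurd (Subsingleton.elim j k) hjk⟩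
  obtain ⟨f, hf⟩ := hon.exists_orthonormalBasis_extension_of_card_eq hE
  exact ⟨f, hf i rfl⟩

lemma isRegularPatch_inter_regular {S : Set E3} {U : Set (ℝ × ℝ)} {x : ℝ × ℝ → E3} (hU : IsOpen U)
    (hx : ContDiffOn ℝ ∞ x U) (hS : Set.MapsTo x U S) :
    IsRegularPatch S (U ∩ {q | cross (du x q) (dv x q) ≠ 0}) x where
  isOpen := by
    refine ContinuousOn.isOpen_inter_preimage (fun q hq => ?_) hU isOpen_compl_singleton
    have hxq := hx.contDiffAt (hU.mem_nhds hq)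
    exact ((crossCLM.continuous.continuousAt.comp (contDiffAt_du hxq).continuousAt).clm_apply
      (contDiffAt_dv hxq).continuousAt).continuousWithinAt
  smooth := hx.mono Set.inter_subset_left
  regular _ hq := hq.2
  mapsTo := hS.mono_left Set.inter_subset_left

/-- A regular patch of `S` around `x p` whose coordinate vectors at `p` are orthonormal. -/
structure IsOrthonormalPatchAt (S : Set E3) (U : Set (ℝ × ℝ)) (x : ℝ × ℝ → E3) (p : ℝ × ℝ) : Prop
    extends IsRegularPatch S U x where
  mem : p ∈ U
  norm_du : ‖du x p‖ = 1
  norm_dv : ‖dv x p‖ = 1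
  inner_du_dv : inner ℝ (du x p) (dv x p) = (0 : ℝ)

lemma exists_isOrthonormalPatchAt {F : E3 → ℝ} (hF : ContDiff ℝ ∞ F) {p N : E3} (hp : F p = 0)
    (hN : HasGradientAt F N p) (hN₀ : N ≠ 0) :
    ∃ U x q, IsOrthonormalPatchAt {y | F y = 0} U x q ∧ x q = p := by
  obtain ⟨f, hf⟩ := exists_orthonormalBasis_apply_eq finrank_euclideanSpace (2 : Fin 3)
    (norm_smul_inv_norm (𝕜 := ℝ) hN₀)
  have hfN (i : Fin 3) (hi : i ≠ 2) : inner ℝ N (f i) = (0 : ℝ) := by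
    have h : inner ℝ (f 2) (f i) = (0 : ℝ) := f.orthonormal.2 hi.symm
    rw [hf, inner_smul_left] at h
    simpa [hN₀] using h
  obtain ⟨V, Ψ, hV, h₀V, hΨ₀, hΨ', hΨ, hFΨ⟩ :=
    exists_contDiffOn_straightening (by simp) hF hp hN hN₀
  let L : ℝ × ℝ →L[ℝ] E3 := (ContinuousLinearMap.fst ℝ ℝ ℝ).smulRight (f 0) +
    (ContinuousLinearMap.snd ℝ ℝ ℝ).smulRight (f 1)
  have hL (z : ℝ × ℝ) : L z = z.1 • f 0 + z.2 • f 1 := rfl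
  have hx' : HasFDerivAt (Ψ ∘ L) L 0 := HasFDerivAt.comp 0 (by rwa [map_zero]) L.hasFDerivAt
  have hdu : du (Ψ ∘ L) 0 = f 0 := by simp [du, hx'.fderiv, hL]
  have hdv : dv (Ψ ∘ L) 0 = f 1 := by simp [dv, hx'.fderiv, hL]
  have h₀₁ : inner ℝ (f 0) (f 1) = (0 : ℝ) := f.orthonormal.2 (by decide)
  refine ⟨_, Ψ ∘ L, 0, ⟨isRegularPatch_inter_regular (hV.preimage L.continuous)
    (hΨ.comp L.contDiff.contDiffOn (Set.mapsTo_preimage L V)) fun q hq => ?_, ⟨?_, ?_⟩, ?_, ?_, ?_⟩,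
    ?_⟩
  · rw [Set.mem_ofPred_eq, Function.comp_apply, hFΨ _ hq, hL, inner_add_right, inner_smul_right,
      inner_smul_right, hfN 0 (by decide), hfN 1 (by decide), mul_zero, mul_zero, add_zero]
  · rwa [Set.mem_preimage, map_zero]
  · intro h
    have := norm_cross_sq (f 0) (f 1)
    rw [hdu, hdv] at h
    simp [h, h₀₁] at this
  · rw [hdu, f.norm_eq_one]
  · rw [hdv, f.norm_eq_one]
  · rw [hdu, hdv, h₀₁]
  · rw [Function.comp_apply, map_zero, hΨ₀]

/-! ### The curvature identity -/

lemma sum_norm_sq_sub_inner_sq {E ι : Type*} [NormedAddCommGroup E] [InnerProductSpace ℝ E]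
    [Fintype ι] (f : OrthonormalBasis ι ℝ E) {H : E →L[ℝ] E} (hH : (H : E →ₗ[ℝ] E).IsSymmetric)
    (k : ι) :
    ∑ i, (‖H (f i)‖ ^ 2 - inner ℝ (H (f i)) (f k) ^ 2) =
      LinearMap.trace ℝ E (H ∘L H) - ‖H (f k)‖ ^ 2 := by
  have htrace : LinearMap.trace ℝ E (H ∘L H) = ∑ i, ‖H (f i)‖ ^ 2 := by
    rw [LinearMap.trace_eq_sum_inner _ f]
    exact Finset.sum_congr rfl fun i _ =>
      (hH (f i) (H (f i))).symm.trans (real_inner_self_eq_norm_sq _)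
  have hnorm : ∑ i, inner ℝ (H (f i)) (f k) ^ 2 = ‖H (f k)‖ ^ 2 := by
    rw [← f.sum_sq_inner_right]
    exact Finset.sum_congr rfl fun i _ => congrArg (· ^ 2) (hH (f i) (f k))
  rw [Finset.sum_sub_distrib, htrace, hnorm]

namespace IsRegularPatch

variable {S : Set E3} {U : Set (ℝ × ℝ)} {x : ℝ × ℝ → E3} {p : ℝ × ℝ}

lemma inner_gaussMap_fderiv_gaussMap (h : IsRegularPatch S U x) (hp : p ∈ U) (z : ℝ × ℝ) :
    inner ℝ (gaussMap x p) (fderiv ℝ (gaussMap x) p z) = (0 : ℝ) := by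
  have hn := h.differentiableAt_gaussMap hp
  have hconst : ∀ᶠ q in 𝓝 p, inner ℝ (gaussMap x q) (gaussMap x q) = (1 : ℝ) :=
    (h.eventually_mem hp).mono fun q hq =>
      inner_self_eq_one_of_norm_eq_one (norm_gaussMap (h.regular q hq))
  linarith [inner_fderiv_add_inner_fderiv_of_inner_eq_const hn hn hconst z,
    real_inner_comm (gaussMap x p) (fderiv ℝ (gaussMap x) p z)]

lemma inner_sq_mul_norm_fderiv_gaussMap_sq (h : IsRegularPatch S U x) (hp : p ∈ U) {N : E3 → E3}
    {H : E3 →L[ℝ] E3} (hN : HasFDerivAt N H (x p))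
    (hort : ∀ q ∈ U, ∀ z, inner ℝ (N (x q)) (fderiv ℝ x q z) = (0 : ℝ)) (z : ℝ × ℝ) :
    inner ℝ (N (x p)) (gaussMap x p) ^ 2 * ‖fderiv ℝ (gaussMap x) p z‖ ^ 2 =
      ‖H (fderiv ℝ x p z)‖ ^ 2 - inner ℝ (H (fderiv ℝ x p z)) (gaussMap x p) ^ 2 := by
  let ρ (q : ℝ × ℝ) : ℝ := inner ℝ (N (x q)) (gaussMap x q)
  have hNx := hN.comp p (h.differentiableAt hp).hasFDerivAt
  have hn := h.differentiableAt_gaussMap hp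
  have hρ : DifferentiableAt ℝ ρ p := hNx.differentiableAt.inner ℝ hn
  have hNρ : N ∘ x =ᶠ[𝓝 p] fun q => ρ q • gaussMap x q :=
    (h.eventually_mem hp).mono fun q hq => h.eq_inner_smul_gaussMap hq (hort q hq)
  have hderiv : H (fderiv ℝ x p z) =
      ρ p • fderiv ℝ (gaussMap x) p z + fderiv ℝ ρ p z • gaussMap x p := by
    have hz := congrArg (· z) hNx.fderiv
    simpa [hNρ.fderiv_eq, fderiv_fun_smul hρ hn] using hz.symm
  have hnn : inner ℝ (gaussMap x p) (gaussMap x p) = (1 : ℝ) :=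
    inner_self_eq_one_of_norm_eq_one (norm_gaussMap (h.regular p hp))
  have hnz := h.inner_gaussMap_fderiv_gaussMap hp z
  rw [hderiv, ← real_inner_self_eq_norm_sq, ← real_inner_self_eq_norm_sq]
  simp only [inner_add_left, inner_add_right, inner_smul_left, inner_smul_right, hnn, hnz,
    real_inner_comm (gaussMap x p), conj_trivial, ρ]
  ring

end IsRegularPatch

namespace IsOrthonormalPatchAt

variable {S : Set E3} {U : Set (ℝ × ℝ)} {x : ℝ × ℝ → E3} {p : ℝ × ℝ}

lemma exists_orthonormalBasis (h : IsOrthonormalPatchAt S U x p) :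
    ∃ f : OrthonormalBasis (Fin 3) ℝ E3, f 0 = du x p ∧ f 1 = dv x p ∧ f 2 = gaussMap x p := by
  have hu : inner ℝ (du x p) (gaussMap x p) = (0 : ℝ) := by
    rw [real_inner_comm]; exact inner_gaussMap_fderiv x p _
  have hv : inner ℝ (dv x p) (gaussMap x p) = (0 : ℝ) := by
    rw [real_inner_comm]; exact inner_gaussMap_fderiv x p _
  have hon : Orthonormal ℝ ![du x p, dv x p, gaussMap x p] := by
    simp [orthonormal_vecCons_iff, Fin.forall_fin_two, h.norm_du, h.norm_dv, h.inner_du_dv, hu, hv,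
      norm_gaussMap (h.regular p h.mem)]
  have hspan := hon.linearIndependent.span_eq_top_of_card_eq_finrank' (by simp)
  exact ⟨OrthonormalBasis.mk hon hspan.ge, by simp⟩

lemma inner_gaussMap_vectorLaplacian (h : IsOrthonormalPatchAt S U x p) :
    inner ℝ (gaussMap x p) (vectorLaplacian x (gaussMap x) p) =
      ‖du (gaussMap x) p‖ ^ 2 + ‖dv (gaussMap x) p‖ ^ 2 := by
  have h₁₁ : g11 x p = 1 := by rw [g11, inner_self_eq_one_of_norm_eq_one h.norm_du]
  have h₁₂ : g12 x p = 0 := h.inner_du_dv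
  have h₂₂ : g22 x p = 1 := by rw [g22, inner_self_eq_one_of_norm_eq_one h.norm_dv]
  have hg : gdet x p = 1 := by rw [gdet, h₁₁, h₁₂, h₂₂]; norm_num
  rw [h.inner_vectorLaplacian_of_norm_eq_one h.mem (h.contDiffAt_gaussMap h.mem)
    ((h.eventually_mem h.mem).mono fun q hq => norm_gaussMap (h.regular q hq))]
  simp [fluxU, fluxV, h₁₁, h₁₂, h₂₂, hg]

lemma norm_sq_mul_inner_vectorLaplacian (h : IsOrthonormalPatchAt S U x p) {N : E3 → E3}
    {H : E3 →L[ℝ] E3} (hH : (H : E3 →ₗ[ℝ] E3).IsSymmetric) (hN : HasFDerivAt N H (x p))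
    (hort : ∀ q ∈ U, ∀ z, inner ℝ (N (x q)) (fderiv ℝ x q z) = (0 : ℝ)) :
    inner ℝ (N (x p)) (gaussMap x p) ^ 2 *
        inner ℝ (gaussMap x p) (vectorLaplacian x (gaussMap x) p) =
      LinearMap.trace ℝ E3 (H ∘L H) - 2 * ‖H (gaussMap x p)‖ ^ 2 +
        inner ℝ (H (gaussMap x p)) (gaussMap x p) ^ 2 := by
  obtain ⟨f, hf₀, hf₁, hf₂⟩ := h.exists_orthonormalBasis
  have hsum := sum_norm_sq_sub_inner_sq f hH 2
  rw [Fin.sum_univ_three, hf₀, hf₁, hf₂] at hsum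
  have hu := h.inner_sq_mul_norm_fderiv_gaussMap_sq h.mem hN hort (1, 0)
  have hv := h.inner_sq_mul_norm_fderiv_gaussMap_sq h.mem hN hort (0, 1)
  rw [h.inner_gaussMap_vectorLaplacian, mul_add, du, dv, hu, hv, ← du, ← dv]
  linarith

end IsOrthonormalPatchAt

section GradientSet

variable {E : Type*} [NormedAddCommGroup E] [InnerProductSpace ℝ E]

/-- The values taken by the gradient of a quadratic polynomial on its zero set. -/
def gradientSet (D : E →L[ℝ] E) (b : E) (c : ℝ) : Set E :=
  (fun y => D y + b) '' {y | quadPoly D b c y = 0}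

/-- The equation `|II|² = ⟪n, L n⟫` on a level set of a function with Hessian `D`, written in terms
of the gradient `N` instead of the unit normal `n = N / ‖N‖`; here `τ` stands for `tr (D²)`. -/
def CurvatureIdentity (D L : E →L[ℝ] E) (τ : ℝ) (N : E) : Prop :=
  (‖N‖ ^ 2) ^ 2 * inner ℝ N (L N) =
    (‖N‖ ^ 2) ^ 2 * τ - 2 * ‖N‖ ^ 2 * ‖D N‖ ^ 2 + inner ℝ (D N) N ^ 2

end GradientSet

lemma GaussMapSatisfies.curvatureIdentity {D : E3 →L[ℝ] E3} {b : E3} {c : ℝ}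
    (hD : (D : E3 →ₗ[ℝ] E3).IsSymmetric) {Λ : Matrix (Fin 3) (Fin 3) ℝ}
    (hΛ : GaussMapSatisfies {y | quadPoly D b c y = 0} Λ) {N : E3} (hN : N ∈ gradientSet D b c) :
    CurvatureIdentity D (Matrix.toEuclideanCLM (𝕜 := ℝ) Λ) (LinearMap.trace ℝ E3 (D ∘L D)) N := by
  obtain ⟨y, hy, rfl : D y + b = N⟩ := hN
  by_cases hN₀ : D y + b = 0
  · simp [CurvatureIdentity, hN₀]
  obtain ⟨U, x, p, h, rfl⟩ := exists_isOrthonormalPatchAt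
    contDiff_quadPoly hy (hasGradientAt_quadPoly hD y) hN₀
  have hort (q) (hq : q ∈ U) := h.inner_gradient_fderiv hq (hasGradientAt_quadPoly hD (x q))
    (fun _ h => h)
  have hid := h.norm_sq_mul_inner_vectorLaplacian hD (D.hasFDerivAt.add_const b) hort
  rw [gaussMapSatisfies_iff.1 hΛ U x h.toIsRegularPatch p h.mem] at hid
  have hNn := h.eq_inner_smul_gaussMap h.mem (hort p h.mem)
  have hn := norm_gaussMap (h.regular p h.mem)
  set ρ : ℝ := inner ℝ (D (x p) + b) (gaussMap x p)
  simp only [CurvatureIdentity, hNn, map_smul, norm_smul, inner_smul_left, inner_smul_right, hn,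
    mul_pow, mul_one, Real.norm_eq_abs, sq_abs, conj_trivial]
  linear_combination ρ ^ 4 * hid

section Slices

open Polynomial

variable {E : Type*} [NormedAddCommGroup E] [InnerProductSpace ℝ E] {D L : E →L[ℝ] E} {τ : ℝ}

lemma isRoot_of_infinite_sq_eq_mul {R : Type*} [CommRing R] [IsDomain R] {q w r : R[X]}
    (h : {s | q.eval s ^ 2 = w.eval s * r.eval s}.Infinite) {s : R} (hs : w.IsRoot s) :
    q.IsRoot s := by
  have hqw : q ^ 2 = w * r := Polynomial.eq_of_infinite_eval_eq _ _ (by simpa using h)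
  have hs' := congrArg (eval s) hqw
  rw [eval_pow, eval_mul, hs.eq_zero, zero_mul] at hs'
  exact pow_eq_zero_iff two_ne_zero |>.1 hs'

lemma norm_sq_add_of_inner_eq_zero {u v : E} (hu : ‖u‖ = 1) (hv : ‖v‖ = 1)
    (huv : inner ℝ u v = (0 : ℝ)) (X Y : ℝ) : ‖X • u + Y • v‖ ^ 2 = X ^ 2 + Y ^ 2 := by
  rw [norm_add_sq_real, inner_smul_left, inner_smul_right, huv, norm_smul, norm_smul, hu, hv]
  simp

/-- The two points `±X u + Y v` are needed to cancel the mixed term of `⟪N, L N⟫`. -/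
lemma isRoot_of_infinite_curvatureIdentity {u v : E} {α β : ℝ} (hu : ‖u‖ = 1) (hv : ‖v‖ = 1)
    (huv : inner ℝ u v = (0 : ℝ)) (hDu : D u = α • u) (hDv : D v = β • v) {ξ η : ℝ[X]}
    (hslice : {s | ∃ X Y : ℝ, X ^ 2 = ξ.eval s ∧ Y ^ 2 = η.eval s ∧
      CurvatureIdentity D L τ (X • u + Y • v) ∧ CurvatureIdentity D L τ (-X • u + Y • v)}.Infinite)
    {s : ℝ} (hs : (ξ + η).IsRoot s) : (C α * ξ + C β * η).IsRoot s := by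
  refine isRoot_of_infinite_sq_eq_mul (r := (ξ + η) *
    (C (inner ℝ u (L u)) * ξ + C (inner ℝ v (L v)) * η - C τ) +
    C 2 * (C (α ^ 2) * ξ + C (β ^ 2) * η)) (hslice.mono ?_) hs
  rintro t ⟨X, Y, hX, hY, h₁, h₂⟩
  have hD (X Y : ℝ) : D (X • u + Y • v) = (X * α) • u + (Y * β) • v := by
    rw [map_add, map_smul, map_smul, hDu, hDv, smul_smul, smul_smul]
  have huu := inner_self_eq_one_of_norm_eq_one (𝕜 := ℝ) hu
  have hvv := inner_self_eq_one_of_norm_eq_one (𝕜 := ℝ) hv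
  simp only [CurvatureIdentity, hD, norm_sq_add_of_inner_eq_zero hu hv huv, map_add, map_smul,
    inner_add_left, inner_add_right, real_inner_smul_left, real_inner_smul_right, huu, hvv, huv,
    real_inner_comm u v] at h₁ h₂
  simp only [Set.mem_ofPred_eq, eval_add, eval_mul, eval_sub, eval_C, ← hX, ← hY]
  linear_combination (-1 / 2 : ℝ) * (h₁ + h₂)

variable {b : E} {c : ℝ}

lemma add_map_mem_gradientSet (hD : (D : E →ₗ[ℝ] E).IsSymmetric) {a w : E}
    (h : quadPoly D b c a + inner ℝ (D a + b) w + inner ℝ (D w) w / 2 = 0) :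
    D a + b + D w ∈ gradientSet D b c :=
  ⟨a + w, (quadPoly_add hD a w).trans h, by simp only [map_add, add_right_comm]⟩

lemma smul_add_smul_mem_gradientSet (hD : (D : E →ₗ[ℝ] E).IsSymmetric) {a : E} (ha : D a + b = 0)
    {u v : E} {α β : ℝ} (hu : ‖u‖ = 1) (hv : ‖v‖ = 1) (huv : inner ℝ u v = (0 : ℝ))
    (hDu : D u = α • u) (hDv : D v = β • v) (hα : α ≠ 0) (hβ : β ≠ 0) {X Y : ℝ}
    (hXY : X ^ 2 / α + Y ^ 2 / β = -2 * quadPoly D b c a) :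
    X • u + Y • v ∈ gradientSet D b c := by
  have hDw : D ((X / α) • u + (Y / β) • v) = X • u + Y • v := by
    rw [map_add, map_smul, map_smul, hDu, hDv, smul_smul, smul_smul, div_mul_cancel₀ _ hα,
      div_mul_cancel₀ _ hβ]
  have h := add_map_mem_gradientSet (c := c) hD (a := a) (b := b)
    (w := (X / α) • u + (Y / β) • v) (by
      rw [hDw, ha]
      simp only [inner_add_left, inner_add_right, inner_smul_left, inner_smul_right, huv,
        real_inner_comm u v, real_inner_self_eq_norm_sq, hu, hv, conj_trivial, inner_zero_left]
      linear_combination hXY / 2)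
  rwa [hDw, ha, zero_add] at h

lemma exists_map_map_add_eq_zero [FiniteDimensional ℝ E] (hD : (D : E →ₗ[ℝ] E).IsSymmetric)
    (b : E) : ∃ a, D (D a + b) = 0 := by
  obtain ⟨_, ⟨y, rfl⟩, z, hz, rfl⟩ :=
    (LinearMap.range (D : E →ₗ[ℝ] E)).exists_add_mem_mem_orthogonal b
  rw [hD.orthogonal_range] at hz
  exact ⟨-y, by simpa using hz⟩

lemma map_add_eq_zero_of_curvatureIdentity (hD : (D : E →ₗ[ℝ] E).IsSymmetric)
    (hG : ∀ N ∈ gradientSet D b c, CurvatureIdentity D L τ N) {u : E} {α : ℝ} (hα : α ≠ 0)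
    (hu : ‖u‖ = 1) (hDu : D u = α • u) {a : E} (ha : D (D a + b) = 0) : D a + b = 0 := by
  by_contra hℓ
  set ℓ := D a + b with hℓ_def
  have hℓ₀ : ‖ℓ‖ ≠ 0 := norm_ne_zero_iff.2 hℓ
  have huℓ : inner ℝ u ℓ = (0 : ℝ) := by
    have h : inner ℝ (D u) ℓ = inner ℝ u (D ℓ) := hD u ℓ
    rw [hDu, ha, inner_smul_left, inner_zero_right] at h
    exact (mul_eq_zero.1 h).resolve_left hα
  have hmem (X : ℝ) : X • u + ‖ℓ‖ • (‖ℓ‖⁻¹ • ℓ) ∈ gradientSet D b c := by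
    have hD' : D ((X / α) • u - ((quadPoly D b c a + X ^ 2 / α / 2) / ‖ℓ‖ ^ 2) • ℓ) = X • u := by
      rw [map_sub, map_smul, map_smul, ha, hDu, smul_zero, sub_zero, smul_smul,
        div_mul_cancel₀ _ hα]
    have h := add_map_mem_gradientSet (c := c) hD (a := a) (b := b)
      (w := (X / α) • u - ((quadPoly D b c a + X ^ 2 / α / 2) / ‖ℓ‖ ^ 2) • ℓ) (by
        rw [hD', ← hℓ_def]
        simp only [inner_sub_right, inner_smul_left, inner_smul_right, huℓ, real_inner_comm u ℓ,
          real_inner_self_eq_norm_sq, hu, conj_trivial]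
        field_simp
        ring)
    rwa [hD', add_comm, ← hℓ_def, ← smul_inv_smul₀ hℓ₀ ℓ] at h
  have hroot := isRoot_of_infinite_curvatureIdentity (α := α) (β := 0) (ξ := X) (η := C (‖ℓ‖ ^ 2))
    (s := -‖ℓ‖ ^ 2) (L := L) (τ := τ) hu
    (norm_smul_inv_norm (𝕜 := ℝ) hℓ) (by rw [inner_smul_right, huℓ, mul_zero]) hDu (by simp [ha])
    ((Set.Ioi_infinite 0).mono fun s hs => ⟨√s, ‖ℓ‖, by simp [Real.sq_sqrt (le_of_lt hs)], by simp,
      hG _ (hmem _), hG _ (hmem _)⟩) (by simp)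
  simp [hα, hℓ₀] at hroot

lemma eq_of_curvatureIdentity (hD : (D : E →ₗ[ℝ] E).IsSymmetric)
    (hG : ∀ N ∈ gradientSet D b c, CurvatureIdentity D L τ N) {a : E} (ha : D a + b = 0) {u v : E}
    {α β : ℝ} (hu : ‖u‖ = 1) (hv : ‖v‖ = 1) (huv : inner ℝ u v = (0 : ℝ)) (hDu : D u = α • u)
    (hDv : D v = β • v) (hα : α * quadPoly D b c a < 0) (hβ : β ≠ 0) : β = α := by
  by_contra hne
  have hα₀ : α ≠ 0 := left_ne_zero_of_mul hα.ne
  set κ : ℝ := -2 * (α * quadPoly D b c a) with hκ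
  have hmem {X Y : ℝ} (hXY : X ^ 2 = κ - α / β * Y ^ 2) : X • u + Y • v ∈ gradientSet D b c :=
    smul_add_smul_mem_gradientSet hD ha hu hv huv hDu hDv hα₀ hβ (by
      rw [hXY, hκ]
      field_simp
      ring)
  have hκ₀ : 0 < κ := by linarith
  have hsmall : ∀ᶠ s in 𝓝 (0 : ℝ), 0 < κ - α / β * s := by
    refine Tendsto.eventually_const_lt hκ₀ ?_
    simpa using (show Continuous fun s : ℝ => κ - α / β * s by fun_prop).tendsto 0
  obtain ⟨δ, hδ, hsub⟩ := mem_nhdsGT_iff_exists_Ioo_subset.1 (nhdsWithin_le_nhds hsmall)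
  have hαβ : α - β ≠ 0 := sub_ne_zero.2 (Ne.symm hne)
  set s₀ : ℝ := κ * β / (α - β) with hs₀_def
  have hs₀ : κ - α / β * s₀ = -s₀ := by
    rw [hs₀_def]
    field_simp
    ring
  have hroot : α * (κ - α / β * s₀) + β * s₀ = 0 := by
    have := isRoot_of_infinite_curvatureIdentity (ξ := C κ - C (α / β) * X) (η := X) (s := s₀)
      (L := L) (τ := τ) hu hv huv hDu hDv ((Set.Ioo_infinite hδ).mono fun s hs => by
        have hY : √s ^ 2 = s := Real.sq_sqrt hs.1.le
        have hX : √(κ - α / β * s) ^ 2 = κ - α / β * √s ^ 2 := by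
          rw [Real.sq_sqrt (le_of_lt (hsub hs)), hY]
        exact ⟨_, √s, by simp [hX, hY], by simp [hY], hG _ (hmem hX),
          hG _ (hmem (by rwa [neg_sq]))⟩)
      (by simp [hs₀])
    simpa using this
  have hs₀_ne : s₀ ≠ 0 := div_ne_zero (mul_ne_zero hκ₀.ne' hβ) hαβ
  exact mul_ne_zero hαβ hs₀_ne (by rw [hs₀] at hroot; linear_combination -hroot)

lemma CurvatureIdentity.eq_zero_of_smul_two {N : E} (h₁ : CurvatureIdentity D L τ N)
    (h₂ : CurvatureIdentity D L τ ((2 : ℝ) • N)) :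
    (‖N‖ ^ 2) ^ 2 * τ - 2 * ‖N‖ ^ 2 * ‖D N‖ ^ 2 + inner ℝ (D N) N ^ 2 = 0 := by
  simp only [CurvatureIdentity, map_smul, norm_smul, real_inner_smul_left, real_inner_smul_right,
    Real.norm_eq_abs, abs_two] at h₁ h₂
  linear_combination (h₂ - 64 * h₁) / 48

lemma eq_sq_add_sq_of_curvatureIdentity (hD : (D : E →ₗ[ℝ] E).IsSymmetric)
    (hG : ∀ N ∈ gradientSet D b c, CurvatureIdentity D L τ N) {a : E} (ha : D a + b = 0)
    (hq : quadPoly D b c a = 0) {u v : E} {α β : ℝ} (hu : ‖u‖ = 1) (hv : ‖v‖ = 1)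
    (huv : inner ℝ u v = (0 : ℝ)) (hDu : D u = α • u) (hDv : D v = β • v) (hα : 0 < α)
    (hβ : β < 0) : τ = α ^ 2 + β ^ 2 := by
  have hX : √α ^ 2 = α := Real.sq_sqrt hα.le
  have hY : √(-β) ^ 2 = -β := Real.sq_sqrt (by linarith)
  have hmem (t : ℝ) : (t * √α) • u + (t * √(-β)) • v ∈ gradientSet D b c :=
    smul_add_smul_mem_gradientSet hD ha hu hv huv hDu hDv hα.ne' hβ.ne (by
      rw [hq, mul_pow, mul_pow, hX, hY]
      field_simp [hβ.ne]
      ring)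
  have hid := CurvatureIdentity.eq_zero_of_smul_two (by simpa using hG _ (hmem 1))
    (by simpa [smul_smul] using hG _ (hmem 2))
  have hDN : D (√α • u + √(-β) • v) = (√α * α) • u + (√(-β) * β) • v := by
    rw [map_add, map_smul, map_smul, hDu, hDv, smul_smul, smul_smul]
  have hin : inner ℝ (D (√α • u + √(-β) • v)) (√α • u + √(-β) • v) = α ^ 2 - β ^ 2 := by
    simp only [hDN, inner_add_left, inner_add_right, real_inner_smul_left, real_inner_smul_right,
      huv, real_inner_comm u v, real_inner_self_eq_norm_sq, hu, hv]
    linear_combination α * hX + β * hY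
  rw [hin, hDN, norm_sq_add_of_inner_eq_zero hu hv huv, norm_sq_add_of_inner_eq_zero hu hv huv,
    mul_pow, mul_pow, hX, hY] at hid
  exact mul_left_cancel₀ (pow_ne_zero 2 (show α - β ≠ 0 by linarith)) (by linear_combination hid)

end Slices

/-! ### Classification -/

section Diagonal

variable {E ι : Type*} [NormedAddCommGroup E] [InnerProductSpace ℝ E] [Fintype ι] {D : E →L[ℝ] E}
  {f : OrthonormalBasis ι ℝ E} {μ : ι → ℝ}

lemma map_eq_sum_of_diagonal (hf : ∀ i, D (f i) = μ i • f i) (w : E) :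
    D w = ∑ i, (μ i * inner ℝ (f i) w) • f i := by
  conv_lhs => rw [← f.sum_repr' w, map_sum]
  exact Finset.sum_congr rfl fun i _ => by rw [map_smul, hf, smul_smul, mul_comm]

lemma inner_map_self_eq_sum_of_diagonal (hf : ∀ i, D (f i) = μ i • f i) (w : E) :
    inner ℝ (D w) w = ∑ i, μ i * inner ℝ (f i) w ^ 2 := by
  rw [map_eq_sum_of_diagonal hf, sum_inner]
  exact Finset.sum_congr rfl fun i _ => by rw [inner_smul_left, conj_trivial]; ring

lemma trace_comp_self_eq_sum_of_diagonal (hf : ∀ i, D (f i) = μ i • f i) :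
    LinearMap.trace ℝ E (D ∘L D) = ∑ i, μ i ^ 2 := by
  rw [LinearMap.trace_eq_sum_inner _ f]
  exact Finset.sum_congr rfl fun i _ => by
    simp [hf, inner_smul_right, sq]

lemma exists_ne_zero_of_diagonal (hf : ∀ i, D (f i) = μ i • f i) (hD₀ : D ≠ 0) : ∃ i, μ i ≠ 0 := by
  by_contra! hμ
  exact hD₀ (ContinuousLinearMap.ext fun w => by simp [map_eq_sum_of_diagonal hf, hμ])

lemma exists_mul_pos_of_inner_map_self (hf : ∀ i, D (f i) = μ i • f i) {t : ℝ} {w : E}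
    (h : 0 < t * inner ℝ (D w) w) : ∃ i, 0 < μ i * t := by
  by_contra! hμ
  rw [inner_map_self_eq_sum_of_diagonal hf, Finset.mul_sum] at h
  refine h.not_ge (Finset.sum_nonpos fun i _ => ?_)
  rw [← mul_assoc, mul_comm t]
  exact mul_nonpos_of_nonpos_of_nonneg (hμ i) (sq_nonneg _)

lemma map_eq_zero_of_inner_map_self_eq_zero (hf : ∀ i, D (f i) = μ i • f i)
    (hμ : (∀ i, 0 ≤ μ i) ∨ ∀ i, μ i ≤ 0) {w : E} (h : inner ℝ (D w) w = (0 : ℝ)) : D w = 0 := by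
  rw [inner_map_self_eq_sum_of_diagonal hf] at h
  have hterm (i : ι) : μ i * inner ℝ (f i) w ^ 2 = 0 := by
    rcases hμ with hμ | hμ
    · exact (Finset.sum_eq_zero_iff_of_nonneg fun i _ => mul_nonneg (hμ i) (sq_nonneg _)).1 h i
        (Finset.mem_univ i)
    · exact (Finset.sum_eq_zero_iff_of_nonpos fun i _ =>
        mul_nonpos_of_nonpos_of_nonneg (hμ i) (sq_nonneg _)).1 h i (Finset.mem_univ i)
  rw [map_eq_sum_of_diagonal hf]
  refine Finset.sum_eq_zero fun i _ => ?_
  have h₀ : μ i * inner ℝ (f i) w = 0 := by simpa using hterm i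
  rw [h₀, zero_smul]

lemma exists_eq_smul_starProjection [FiniteDimensional ℝ E] (hD : (D : E →ₗ[ℝ] E).IsSymmetric)
    (hf : ∀ i, D (f i) = μ i • f i) {α : ℝ} (hα : α ≠ 0) (hμ : ∀ i, μ i = 0 ∨ μ i = α) :
    ∃ K : Submodule ℝ E, D = α • K.starProjection := by
  have hsq : D ∘L D = α • D := by
    refine ContinuousLinearMap.coe_injective (f.toBasis.ext fun i => ?_)
    rcases hμ i with h | h <;> simp [hf, h]
  have hproj : IsStarProjection (α⁻¹ • D) := by
    refine ⟨?_, (hD.smul (by simp)).isSelfAdjoint⟩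
    rw [IsIdempotentElem, smul_mul_smul_comm, ContinuousLinearMap.mul_def, hsq, smul_smul,
      inv_mul_cancel_right₀ hα]
  obtain ⟨K, _, hK⟩ := isStarProjection_iff_eq_starProjection.1 hproj
  exact ⟨K, by rw [← hK, smul_inv_smul₀ hα]⟩

end Diagonal

section Submodules

variable {E : Type*} [NormedAddCommGroup E] [InnerProductSpace ℝ E]

lemma exists_eq_span_singleton_of_finrank_eq_one {K : Submodule ℝ E}
    (hK : Module.finrank ℝ K = 1) : ∃ v : E, ‖v‖ = 1 ∧ K = ℝ ∙ v := by
  obtain ⟨⟨v, hv⟩, hv₀, hspan⟩ := finrank_eq_one_iff'.1 hK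
  have hv₀' : v ≠ 0 := fun h => hv₀ (Subtype.ext h)
  refine ⟨‖v‖⁻¹ • v, norm_smul_inv_norm hv₀', ?_⟩
  rw [Submodule.span_singleton_smul_eq (by simpa using hv₀')]
  refine le_antisymm (fun w hw => ?_) ((Submodule.span_singleton_le_iff_mem _ _).2 hv)
  obtain ⟨t, ht⟩ := hspan ⟨w, hw⟩
  exact Submodule.mem_span_singleton.2 ⟨t, congrArg Subtype.val ht⟩

lemma exists_quadPoly_eq_tube {D : E →L[ℝ] E} {b a : E} {c : ℝ}
    (hD : (D : E →ₗ[ℝ] E).IsSymmetric) (ha : D a + b = 0) {K : Submodule ℝ E}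
    [K.HasOrthogonalProjection] {α : ℝ} (hK : D = α • K.starProjection)
    (hα : α * quadPoly D b c a < 0) :
    ∃ r, 0 < r ∧ {y | quadPoly D b c y = 0} = tube K a r := by
  have hα₀ : α ≠ 0 := left_ne_zero_of_mul hα.ne
  have hpos : 0 < -2 * quadPoly D b c a / α := by
    have h : -2 * quadPoly D b c a / α = 2 * -(α * quadPoly D b c a) / α ^ 2 := by field_simp
    rw [h]
    exact div_pos (by linarith) (by positivity)
  refine ⟨√(-2 * quadPoly D b c a / α), Real.sqrt_pos.2 hpos, Set.ext fun y => ?_⟩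
  have hDy : inner ℝ (D (y - a)) (y - a) = α * ‖K.starProjection (y - a)‖ ^ 2 := by
    rw [hK, smul_apply, real_inner_smul_left, inner_starProjection_self]
  have hy := quadPoly_add (b := b) (c := c) hD a (y - a)
  rw [add_sub_cancel, ha, inner_zero_left, add_zero, hDy] at hy
  rw [tube, Set.mem_ofPred_eq, Set.mem_ofPred_eq, hy, eq_comm (b := √_),
    Real.sqrt_eq_iff_eq_sq hpos.le (norm_nonneg _), div_eq_iff hα₀]
  constructor <;> intro h <;> linarith

end Submodules

lemma isPlane_setOf_inner_sub {v : E3} (hv : v ≠ 0) (a : E3) (d : ℝ) :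
    IsPlane {y | inner ℝ v (y - a) = d} :=
  ⟨v, d + inner ℝ v a, hv, by simp only [inner_sub_right, sub_eq_iff_eq_add]⟩

/-- `S` is the union of two distinct planes. -/
def IsPairOfPlanes (S : Set E3) : Prop :=
  ∃ P Q : Set E3, IsPlane P ∧ IsPlane Q ∧ P ≠ Q ∧ S = P ∪ Q

lemma isPairOfPlanes_tube_span_singleton {v : E3} (hv : ‖v‖ = 1) (a : E3) {r : ℝ} (hr : 0 < r) :
    IsPairOfPlanes (tube (ℝ ∙ v) a r) := by
  have hv₀ : v ≠ 0 := norm_ne_zero_iff.1 (hv ▸ one_ne_zero)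
  refine ⟨_, _, isPlane_setOf_inner_sub hv₀ a r, isPlane_setOf_inner_sub hv₀ a (-r), fun h => ?_,
    ?_⟩
  · have hmem : a + r • v ∈ {y | inner ℝ v (y - a) = -r} := by
      rw [← h]
      simp [inner_smul_right, hv]
    simp [inner_smul_right, hv] at hmem
    linarith
  · ext y
    simp [tube_span_singleton hv, abs_eq hr.le]

lemma isCircularCylinder_or_isSphere_of_tube {K : Submodule ℝ E3} {a : E3} {r : ℝ} (hr : 0 < r)
    (hne : (tube K a r).Nonempty) (hpair : ¬IsPairOfPlanes (tube K a r)) :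
    IsCircularCylinder (tube K a r) ∨ IsSphere (tube K a r) := by
  have hsum := K.finrank_add_finrank_orthogonal
  rw [finrank_euclideanSpace_fin] at hsum
  obtain h | h | h | h : Module.finrank ℝ K = 0 ∨ Module.finrank ℝ K = 1 ∨
      Module.finrank ℝ Kᗮ = 1 ∨ Module.finrank ℝ K = 3 := by omega
  · obtain ⟨y, hy⟩ := hne
    rw [Submodule.finrank_eq_zero] at h
    subst h
    simp [tube, hr.ne] at hy
  · obtain ⟨v, hv, rfl⟩ := exists_eq_span_singleton_of_finrank_eq_one h
    exact absurd (isPairOfPlanes_tube_span_singleton hv a hr) hpair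
  · obtain ⟨v, hv, hK⟩ := exists_eq_span_singleton_of_finrank_eq_one h
    obtain rfl : K = (ℝ ∙ v)ᗮ := by rw [← hK, K.orthogonal_orthogonal]
    exact Or.inl ⟨a, v, r, hv, hr, tube_orthogonal_span_singleton hv⟩
  · obtain rfl : K = ⊤ := Submodule.eq_top_of_finrank_eq (by simp [h])
    exact Or.inr ⟨a, r, hr, tube_top⟩

lemma isPairOfPlanes_of_diagonal {D : E3 →L[ℝ] E3} {f : OrthonormalBasis (Fin 3) ℝ E3}
    {μ : Fin 3 → ℝ} (hf : ∀ i, D (f i) = μ i • f i) {i j : Fin 3} (hi : 0 < μ i) (hj : μ j < 0)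
    (hμ : ∀ k, k ≠ i → k ≠ j → μ k = 0) (a : E3) :
    IsPairOfPlanes {y | inner ℝ (D (y - a)) (y - a) = (0 : ℝ)} := by
  have hij : i ≠ j := fun h => by rw [h] at hi; linarith
  have hii : inner ℝ (f i) (f i) = (1 : ℝ) := by simp
  have hjj : inner ℝ (f j) (f j) = (1 : ℝ) := by simp
  have hij' : inner ℝ (f i) (f j) = (0 : ℝ) := f.orthonormal.2 hij
  obtain ⟨α, hα, hαi⟩ : ∃ α, 0 < α ∧ α ^ 2 = μ i := ⟨√(μ i), Real.sqrt_pos.2 hi, Real.sq_sqrt hi.le⟩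
  obtain ⟨β, hβ, hβj⟩ : ∃ β, 0 < β ∧ β ^ 2 = -μ j :=
    ⟨√(-μ j), Real.sqrt_pos.2 (by linarith), Real.sq_sqrt (by linarith)⟩
  have hnormal (γ : ℝ) : α • f i + γ • f j ≠ 0 := fun h => by
    have h' := congrArg (inner ℝ (f i)) h
    simp only [inner_add_right, real_inner_smul_right, hii, hij', inner_zero_right] at h'
    linarith
  have hfactor (w : E3) : inner ℝ (D w) w =
      inner ℝ (α • f i + β • f j) w * inner ℝ (α • f i + (-β) • f j) w := by
    rw [inner_map_self_eq_sum_of_diagonal hf, Finset.sum_eq_add_of_mem i j (Finset.mem_univ i)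
      (Finset.mem_univ j) hij fun k _ hk => by rw [hμ k hk.1 hk.2, zero_mul]]
    simp only [inner_add_left, real_inner_smul_left]
    linear_combination -inner ℝ (f i) w ^ 2 * hαi + inner ℝ (f j) w ^ 2 * hβj
  refine ⟨_, _, isPlane_setOf_inner_sub (hnormal β) a 0, isPlane_setOf_inner_sub (hnormal (-β)) a 0,
    fun h => ?_, Set.ext fun y => by
      rw [Set.mem_union, Set.mem_ofPred_eq, hfactor, mul_eq_zero]; rfl⟩
  have hmem := Set.ext_iff.1 h (a + (β • f i - α • f j))
  rw [Set.mem_ofPred_eq, Set.mem_ofPred_eq, add_sub_cancel_left] at hmem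
  simp only [inner_add_left, inner_sub_right, real_inner_smul_left, real_inner_smul_right, hii, hjj,
    hij', real_inner_comm (f i) (f j)] at hmem
  exact (mul_pos hα hβ).ne' (by linear_combination hmem.1 (by ring) / 2)

lemma isPlane_setOf_map_sub_eq_zero {D : E3 →L[ℝ] E3} (hD : (D : E3 →ₗ[ℝ] E3).IsSymmetric)
    (hD₀ : D ≠ 0) {a : E3} {U : Set (ℝ × ℝ)} {x : ℝ × ℝ → E3} (hU : U.Nonempty)
    (h : IsRegularPatch {y | D (y - a) = 0} U x) : IsPlane {y | D (y - a) = 0} := by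
  obtain ⟨p, hp⟩ := hU
  have hconst : D ∘ x =ᶠ[𝓝 p] fun _ => D a := (h.eventually_mem hp).mono fun q hq =>
    sub_eq_zero.1 ((map_sub D _ _).symm.trans (h.mapsTo hq))
  have htangent (z) : D (fderiv ℝ x p z) = 0 := by
    have hz := congrArg (· z) (D.hasFDerivAt.comp p (h.differentiableAt hp).hasFDerivAt).fderiv
    simpa [hconst.fderiv_eq] using hz.symm
  have hDw (w : E3) : D w = (inner ℝ (D (gaussMap x p)) w : ℝ) • gaussMap x p := by
    have hD' (w' : E3) : inner ℝ (D w) w' = inner ℝ w (D w') := hD w w'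
    rw [real_inner_comm, ← hD']
    exact h.eq_inner_smul_gaussMap hp fun z => by rw [hD', htangent, inner_zero_right]
  have hn : D (gaussMap x p) ≠ 0 := fun hn =>
    hD₀ (ContinuousLinearMap.ext fun w => by simp [hDw w, hn])
  have hn₀ : gaussMap x p ≠ 0 := fun h => hn (by rw [h, map_zero])
  convert isPlane_setOf_inner_sub hn a 0 using 3 with y
  simp [hDw (y - a), hn₀]

section Classification

variable {D L : E3 →L[ℝ] E3} {b a : E3} {c : ℝ} {f : OrthonormalBasis (Fin 3) ℝ E3}
  {μ : Fin 3 → ℝ}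

lemma isCircularCylinder_or_isSphere_of_curvatureIdentity (hD : (D : E3 →ₗ[ℝ] E3).IsSymmetric)
    (hf : ∀ i, D (f i) = μ i • f i) {τ : ℝ}
    (hG : ∀ N ∈ gradientSet D b c, CurvatureIdentity D L τ N) (ha : D a + b = 0)
    (hq : quadPoly D b c a ≠ 0) (hne : {y | quadPoly D b c y = 0}.Nonempty)
    (hpair : ¬IsPairOfPlanes {y | quadPoly D b c y = 0}) :
    IsCircularCylinder {y | quadPoly D b c y = 0} ∨ IsSphere {y | quadPoly D b c y = 0} := by
  obtain ⟨i, hi⟩ : ∃ i, μ i * quadPoly D b c a < 0 := by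
    obtain ⟨y, hy⟩ := hne
    have hDy := quadPoly_add (b := b) (c := c) hD a (y - a)
    rw [add_sub_cancel, ha, inner_zero_left, add_zero, hy] at hDy
    have hin : inner ℝ (D (y - a)) (y - a) = -2 * quadPoly D b c a := by linarith
    obtain ⟨i, hi⟩ := exists_mul_pos_of_inner_map_self hf (t := -quadPoly D b c a) (w := y - a)
      (by rw [hin]; linarith [sq_pos_of_ne_zero hq])
    exact ⟨i, by linarith⟩
  have hμ (j : Fin 3) : μ j = 0 ∨ μ j = μ i := by
    rcases eq_or_ne i j with rfl | hij
    · exact Or.inr rfl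
    · exact or_iff_not_imp_left.2 fun hj => eq_of_curvatureIdentity hD hG ha (f.norm_eq_one i)
        (f.norm_eq_one j) (f.orthonormal.2 hij) (hf i) (hf j) hi hj
  obtain ⟨K, hK⟩ := exists_eq_smul_starProjection hD hf (left_ne_zero_of_mul hi.ne) hμ
  obtain ⟨r, hr, htube⟩ := exists_quadPoly_eq_tube hD ha hK hi
  rw [htube] at hne hpair ⊢
  exact isCircularCylinder_or_isSphere_of_tube hr hne hpair

lemma isPlane_of_curvatureIdentity (hD : (D : E3 →ₗ[ℝ] E3).IsSymmetric) (hD₀ : D ≠ 0)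
    (hf : ∀ i, D (f i) = μ i • f i)
    (hG : ∀ N ∈ gradientSet D b c, CurvatureIdentity D L (LinearMap.trace ℝ E3 (D ∘L D)) N)
    (ha : D a + b = 0) (hq : quadPoly D b c a = 0) {U : Set (ℝ × ℝ)} {x : ℝ × ℝ → E3}
    (hU : U.Nonempty) (hx : IsRegularPatch {y | quadPoly D b c y = 0} U x)
    (hpair : ¬IsPairOfPlanes {y | quadPoly D b c y = 0}) :
    IsPlane {y | quadPoly D b c y = 0} := by
  have hcone : {y | quadPoly D b c y = 0} = {y | inner ℝ (D (y - a)) (y - a) = (0 : ℝ)} := by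
    ext y
    have hy := quadPoly_add (b := b) (c := c) hD a (y - a)
    rw [add_sub_cancel, ha, inner_zero_left, add_zero, hq, zero_add] at hy
    simp [hy]
  have hμ : (∀ i, 0 ≤ μ i) ∨ ∀ i, μ i ≤ 0 := by
    by_contra! hmixed
    obtain ⟨⟨j, hj⟩, i, hi⟩ := hmixed
    have hij : i ≠ j := fun h => by rw [h] at hi; linarith
    have htrace := eq_sq_add_sq_of_curvatureIdentity hD hG ha hq (f.norm_eq_one i)
      (f.norm_eq_one j) (f.orthonormal.2 hij) (hf i) (hf j) hi hj
    rw [trace_comp_self_eq_sum_of_diagonal hf, ← Finset.sum_pair (f := fun k => μ k ^ 2) hij,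
      ← Finset.sum_sdiff (Finset.subset_univ {i, j}), add_eq_right,
      Finset.sum_eq_zero_iff_of_nonneg fun k _ => sq_nonneg (μ k)] at htrace
    exact hpair (hcone ▸ isPairOfPlanes_of_diagonal hf hi hj
      (fun k hki hkj => pow_eq_zero_iff two_ne_zero |>.1 (htrace k (by simp [hki, hkj]))) a)
  have hker : {y | quadPoly D b c y = 0} = {y | D (y - a) = 0} := hcone.trans <| Set.ext fun y =>
    ⟨map_eq_zero_of_inner_map_self_eq_zero hf hμ, fun hy => by
      rw [Set.mem_ofPred_eq] at hy ⊢; rw [hy, inner_zero_left]⟩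
  rw [hker] at hx ⊢
  exact isPlane_setOf_map_sub_eq_zero hD hD₀ hU hx

end Classification

lemma IsQuadric.exists_quadPoly {S : Set E3} (h : IsQuadric S) :
    ∃ (D : E3 →L[ℝ] E3) (b : E3) (c : ℝ), (D : E3 →ₗ[ℝ] E3).IsSymmetric ∧ D ≠ 0 ∧
      S = {y | quadPoly D b c y = 0} := by
  obtain ⟨A, b, c, hA, hA₀, rfl⟩ := h
  set T : E3 →L[ℝ] E3 := Matrix.toEuclideanCLM (𝕜 := ℝ) A with hT
  have hself : IsSelfAdjoint T := .map (f := Matrix.toEuclideanCLM (𝕜 := ℝ))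
    ((Matrix.conjTranspose_eq_transpose_of_trivial A).trans hA)
  have hT₀ : T ≠ 0 := (EmbeddingLike.map_ne_zero_iff (f := Matrix.toEuclideanCLM (𝕜 := ℝ))).2 hA₀
  have hinner (y : E3) : inner ℝ (T y) y = ∑ i, ∑ j, A i j * y i * y j := by
    simp [hT, PiLp.inner_apply, Matrix.mulVec, dotProduct, Finset.mul_sum, mul_left_comm, mul_assoc]
  refine ⟨(2 : ℝ) • T, WithLp.toLp 2 b, c, hself.isSymmetric.smul (by simp),
    smul_ne_zero two_ne_zero hT₀, Set.ext fun y => ?_⟩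
  rw [Set.mem_ofPred_eq, Set.mem_ofPred_eq, quadPoly, smul_apply, real_inner_smul_left, hinner,
    mul_div_cancel_left₀ _ two_ne_zero]
  simp [PiLp.inner_apply, mul_comm]

end QuadricGauss

/-- A quadric surface in Euclidean 3-space has a Gauss map satisfying `Δ n = Λ n` for some constant
real `3 × 3` matrix `Λ` if and only if it is a plane, a circular cylinder or a sphere. -/
theorem theorem3 (S : Set QuadricGauss.E3) (hS : QuadricGauss.IsQuadricSurface S) :
    (∃ Λ : Matrix (Fin 3) (Fin 3) ℝ, QuadricGauss.GaussMapSatisfies S Λ) ↔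
      (QuadricGauss.IsPlane S ∨ QuadricGauss.IsCircularCylinder S ∨ QuadricGauss.IsSphere S) := by
  refine ⟨fun ⟨Λ, hΛ⟩ => ?_, QuadricGauss.exists_gaussMapSatisfies⟩
  obtain ⟨D, b, c, hD, hD₀, rfl⟩ := hS.isQuadric.exists_quadPoly
  have hG (N) (hN : N ∈ QuadricGauss.gradientSet D b c) := hΛ.curvatureIdentity hD hN
  set f := hD.eigenvectorBasis finrank_euclideanSpace_fin
  have hf := hD.apply_eigenvectorBasis finrank_euclideanSpace_fin
  obtain ⟨i, hi⟩ := QuadricGauss.exists_ne_zero_of_diagonal hf hD₀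
  obtain ⟨a, ha⟩ := QuadricGauss.exists_map_map_add_eq_zero hD b
  have hcenter : D a + b = 0 :=
    QuadricGauss.map_add_eq_zero_of_curvatureIdentity hD hG hi (f.norm_eq_one i) (hf i) ha
  obtain ⟨U, x, hU, hx⟩ := hS.exists_patch
  by_cases hq : QuadricGauss.quadPoly D b c a = 0
  · exact Or.inl (QuadricGauss.isPlane_of_curvatureIdentity hD hD₀ hf hG hcenter hq hU hx
      hS.not_pair_of_planes)
  · obtain ⟨p, hp⟩ := hU
    exact Or.inr (QuadricGauss.isCircularCylinder_or_isSphere_of_curvatureIdentity hD hf hG hcenter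
      hq ⟨x p, hx.mapsTo hp⟩ hS.not_pair_of_planes)
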